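/- **Circuits.** Write $\mathbb{R}^*=\bigcup_{n\ge 0}\mathbb{R}^n$. An *extended arithmetic circuit* with $n$ inputs, $\ell$ auxiliary memory gates and $m$ outputs is a finite simple directed acyclic graph whose gates are: $n$ ordered input gates and $\ell$ ordered auxiliary memory gates (indegree $0$), real constant gates (indegree $0$), addition and multiplication gates of unbounded fan-in, $m$ ordered output gates (indegree $1$, outdegree $0$), and possibly gates computing a function $f\colon\mathbb{R}\to\mathbb{R}$ (indegree and outdegree $1$). Its size is the number of gates and its depth the length of a longest directed path. For $i\in\mathbb{N}$ and a set $\mathcal{B}$ of functions $\mathbb{R}\to\mathbb{R}$ let $\mathfrak{F}=\mathrm{FAC}^i_{\mathbb{R}}[\mathcal{B}]$: an *$\mathfrak{F}$-circuit family* is a sequence $(C_n)_{n\in\mathbb{N}}$ of such circuits, $C_n$ with $n$ inputs, of size $\mathcal{O}(n^{\mathcal{O}(1)})$ and depth $\mathcal{O}((\log n)^i)$, with function gates only for functions in $\mathcal{B}$. For a set $\mathcal{A}$ of functions put $\mathfrak{F}[\mathcal{A}]=\mathrm{FAC}^i_{\mathbb{R}}[\mathcal{B}\cup\mathcal{A}]$,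 and $\mathfrak{F}_s=\mathfrak{F}[\mathrm{sign}]$, where $\mathrm{sign}(x)=1$ if $x>0$ and $\mathrm{sign}(x)=0$ otherwise. **Recurrent circuits.** A *recurrent circuit* is an extended circuit $C$ (the underlying circuit) together with initial values of the auxiliary memory gates, one recurrent edge into each input and each auxiliary memory gate, coming from any gate that is not an output gate, an ordered set of $p$ halting gates, and a halting function $f_{\mathrm{halt}}\colon\mathbb{N}_{>0}\times\mathbb{R}^p\to\{0,1\}$. It evaluates $C$ repeatedly: if in iteration $t=1,2,\dots$ the halting function, applied to $t$ and the values of the halting gates, is $1$, then the values of the output gates are returned; otherwise every memory gate takes the value of the source of its recurrent edge and iteration $t+1$ begins. If this never stops, the result is undefined. The class $\mathrm{rec}[\mathfrak{F}']\text{-}\mathfrak{F}''$ consists of the partial functions $\mathbb{R}^*\to\mathbb{R}^*$ computed by families $(R_n)_{n\in\mathbb{N}}$ of recurrent circuits, $R_n$ with $n$ inputs, whose underlying circuits form an $\mathfrak{F}''$-circuit family, and for which there is an $\mathfrak{F}'$-circuit family $(H_k)_{k\in\mathbb{N}}$ of circuits with one output and without memory gates such that the halting function of $R_n$ is computed by $H_{p+1}$,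 where $p$ is the number of halting gates of $R_n$ and the first input is the iteration number. **Networks.** A labelled graph $\mathfrak{G}=(V,E,g_V)$ is a finite simple undirected graph with an ordered set of vertices and $g_V\colon V\to\mathbb{R}$. Its encoding $\langle\mathfrak{G}\rangle\in\mathbb{R}^{|V|^2+|V|}$ is the adjacency matrix, row by row, followed by the feature values in the order of $V$. A *$(\mathrm{rec}[t\mathfrak{F}_s]\text{-}t\mathfrak{F},\mathcal{A})$-GNN* $\textit{rec-}\mathcal{N}$ (a circuit GNN with inner recurrence only) is given by a fixed number $d\ge 1$ of layers and a periodic sequence of pairs $(f_k,\sigma_k)$, $k\in\mathbb{N}$, where $\sigma_k\in\mathcal{A}$ and $f_k$ is a real-valued partial function on $\mathbb{R}^*$ in $\mathrm{rec}[\mathfrak{F}_s]\text{-}\mathfrak{F}$ that is tail-symmetric, i.e. invariant under permutations of all arguments but the first. Put $h^{(0)}=g_V$ and, for $k\ge 1$, $$h^{(k)}(v)=\sigma_k\bigl(f_k\bigl(h^{(k-1)}(v),\{\!\{h^{(k-1)}(u)\mid \{u,v\}\in E\}\!\}\bigr)\bigr)\qquad(v\in V).$$ Then $f_{\textit{rec-}\mathcal{N}}(\mathfrak{G})=(V,E,h^{(d)})$,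 which is undefined if some value occurring in its definition is undefined. **Theorem.** Let $\mathfrak{F}=\mathrm{FAC}^i_{\mathbb{R}}[\mathcal{B}]$ for some $i\in\mathbb{N}$ and some set $\mathcal{B}$ of functions $\mathbb{R}\to\mathbb{R}$, let $\mathcal{A}$ be a set of functions $\mathbb{R}\to\mathbb{R}$, and let $\textit{rec-}\mathcal{N}$ be a $(\mathrm{rec}[t\mathfrak{F}_s]\text{-}t\mathfrak{F},\mathcal{A})$-GNN. Then there is a function $f_{\mathrm{circ}}\in\mathrm{rec}[\mathfrak{F}_s]\text{-}\mathfrak{F}_s[\mathcal{A}]$ such that for all labelled graphs $\mathfrak{G}$ $$f_{\mathrm{circ}}(\langle\mathfrak{G}\rangle)=\langle f_{\textit{rec-}\mathcal{N}}(\mathfrak{G})\rangle,$$ where one side is defined if and only if the other is. Moreover, if all layer functions $f_k$ are total, then $f_{\mathrm{circ}}$ can be chosen to be total on $\mathbb{R}^*$. -/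

import Mathlib

open Filter Asymptotics

noncomputable section

namespace RecGNN

/-! ### Extended arithmetic circuits -/

/-- Labels of the gates of an extended arithmetic circuit with `n` inputs, `ℓ` auxiliary memory
gates and `m` outputs on the set of gates `γ`, together with the predecessors of the gate.
Arithmetic gates have unbounded fan-in; as the graph is simple, the predecessors form a set. -/
inductive GateLabel (n ℓ m : ℕ) (γ : Type) : Type
  | input (j : Fin n)
  | aux (j : Fin ℓ)
  | const (c : ℝ)
  | add (s : Finset γ)
  | mul (s : Finset γ)
  | func (f : ℝ → ℝ) (h : γ)
  | output (j : Fin m) (h : γ)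

namespace GateLabel

variable {n ℓ m : ℕ} {γ : Type}

/-- The set of predecessors of a gate. -/
def preds : GateLabel n ℓ m γ → Finset γ
  | input _ => ∅
  | aux _ => ∅
  | const _ => ∅
  | add s => s
  | mul s => s
  | func _ h => {h}
  | output _ h => {h}

/-- The value of a gate, given the values `x` of the input gates, `a` of the auxiliary memory
gates, and `v` of the other gates (only the values of the predecessors are used). -/
def apply (x : Fin n → ℝ) (a : Fin ℓ → ℝ) (v : γ → ℝ) : GateLabel n ℓ m γ → ℝ
  | input j => x j
  | aux j => a j
  | const c => c
  | add s => ∑ h ∈ s, v h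
  | mul s => ∏ h ∈ s, v h
  | func f h => f (v h)
  | output _ h => v h

theorem apply_congr (x : Fin n → ℝ) (a : Fin ℓ → ℝ) {v w : γ → ℝ} (L : GateLabel n ℓ m γ)
    (hvw : ∀ h ∈ L.preds, v h = w h) : L.apply x a v = L.apply x a w := by
  cases L with
  | add s => exact Finset.sum_congr rfl hvw
  | mul s => exact Finset.prod_congr rfl hvw
  | func f h => exact congrArg f (hvw h (by simp [preds]))
  | output j h => exact hvw h (by simp [preds])
  | _ => rfl

end GateLabel

/-- An extended arithmetic circuit with `n` inputs, `ℓ` auxiliary memory gates and `m` outputs: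
a finite directed acyclic graph of gates. For `ℓ = 0` it is an (ordinary) arithmetic circuit. -/
structure ExtCircuit (n ℓ m : ℕ) where
  /-- The set of gates. -/
  Gate : Type
  fintypeGate : Fintype Gate
  label : Gate → GateLabel n ℓ m Gate
  /-- The graph is acyclic (on a finite graph this is well-foundedness of the edge relation). -/
  acyclic : WellFounded fun g h : Gate => g ∈ (label h).preds
  inGate : Fin n → Gate
  auxGate : Fin ℓ → Gate
  outGate : Fin m → Gate
  /-- There is exactly one `j`-th input gate. -/
  label_input : ∀ g j, label g = .input j ↔ g = inGate j
  /-- There is exactly one `j`-th auxiliary memory gate. -/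
  label_aux : ∀ g j, label g = .aux j ↔ g = auxGate j
  /-- There is exactly one `j`-th output gate. -/
  label_output : ∀ g j, (∃ h, label g = .output j h) ↔ g = outGate j
  /-- Output gates have outdegree zero. -/
  outGate_fanout : ∀ j g, outGate j ∉ (label g).preds
  /-- Gates for additional functions have outdegree one. -/
  func_fanout : ∀ g f p, label g = .func f p → ∃! h, g ∈ (label h).preds

attribute [instance] ExtCircuit.fintypeGate

namespace ExtCircuit

variable {n ℓ m : ℕ} (C : ExtCircuit n ℓ m)

open Classical in
/-- The value of the gate `g` on input `x` with auxiliary memory values `a`. -/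
def val (x : Fin n → ℝ) (a : Fin ℓ → ℝ) : C.Gate → ℝ :=
  C.acyclic.fix fun g v =>
    (C.label g).apply x a fun h => if hh : h ∈ (C.label g).preds then v h hh else 0

theorem val_eq (x : Fin n → ℝ) (a : Fin ℓ → ℝ) (g : C.Gate) :
    C.val x a g = (C.label g).apply x a (C.val x a) := by
  classical
  rw [val, WellFounded.fix_eq]
  refine GateLabel.apply_congr x a _ fun h hh => ?_
  simp [hh]

/-- The function computed by the circuit. -/
def eval (x : Fin n → ℝ) (a : Fin ℓ → ℝ) : Fin m → ℝ := fun j => C.val x a (C.outGate j)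

/-- The number of gates. -/
def size : ℕ := Fintype.card C.Gate

/-- The length of a longest directed path ending in the gate `g`. -/
def level : C.Gate → ℕ :=
  C.acyclic.fix fun g lev => (C.label g).preds.attach.sup fun h => lev h.1 h.2 + 1

theorem level_eq (g : C.Gate) :
    C.level g = (C.label g).preds.sup fun h => C.level h + 1 := by
  rw [level, WellFounded.fix_eq]
  exact Finset.sup_attach _ fun h => C.level h + 1

/-- The length of a longest directed path between any two gates. -/
def depth : ℕ := Finset.univ.sup C.level

/-- The additional functions used as gate types all belong to `A`. -/
def UsesOnly (A : Set (ℝ → ℝ)) : Prop := ∀ g f p, C.label g = .func f p → f ∈ A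

end ExtCircuit

/-! ### Circuit families and circuit function classes -/

/-- A family of extended arithmetic circuits, the `n`-th one having `n` inputs. -/
structure ExtFamily where
  aux : ℕ → ℕ
  out : ℕ → ℕ
  circ : ∀ n, ExtCircuit n (aux n) (out n)

/-- The data `i` and `A` of a circuit function class `FAC^i[A]` over the reals. -/
structure CircuitClass where
  depthExp : ℕ
  gates : Set (ℝ → ℝ)

/-- `𝔉[A]`: the class `𝔉` with additional gates for the functions in `A`. -/
def CircuitClass.adjoin (𝔉 : CircuitClass) (A : Set (ℝ → ℝ)) : CircuitClass :=
  ⟨𝔉.depthExp, 𝔉.gates ∪ A⟩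

/-- The sign function: `1` on positive numbers and `0` otherwise. -/
def sgn (x : ℝ) : ℝ := if 0 < x then 1 else 0

/-- `𝔉_s = 𝔉[sign]`. -/
def CircuitClass.withSign (𝔉 : CircuitClass) : CircuitClass := 𝔉.adjoin {sgn}

/-- `F` is an `𝔉`-circuit family for `𝔉 = FAC^i[A]`: size `n ^ O(1)`, depth `O((log n) ^ i)`, and
additional gates only for functions in `A`. -/
def ExtFamily.IsFamilyOf (F : ExtFamily) (𝔉 : CircuitClass) : Prop :=
  (∃ k : ℕ, (fun n : ℕ => ((F.circ n).size : ℝ)) =O[atTop] fun n : ℕ => (n : ℝ) ^ k) ∧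
  ((fun n : ℕ => ((F.circ n).depth : ℝ)) =O[atTop]
    fun n : ℕ => Real.log (n : ℝ) ^ 𝔉.depthExp) ∧
  ∀ n, (F.circ n).UsesOnly 𝔉.gates

/-! ### Recurrent arithmetic circuits -/

/-- A recurrent arithmetic circuit with `n` inputs. -/
structure RecCircuit (n : ℕ) where
  /-- Number of auxiliary memory gates. -/
  aux : ℕ
  /-- Number of outputs. -/
  out : ℕ
  /-- The underlying extended arithmetic circuit. -/
  C : ExtCircuit n aux out
  /-- Initial values of the auxiliary memory gates. -/
  init : Fin aux → ℝ
  /-- The source of the recurrent edge into the `j`-th input gate. -/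
  recIn : Fin n → C.Gate
  /-- The source of the recurrent edge into the `j`-th auxiliary memory gate. -/
  recAux : Fin aux → C.Gate
  /-- No recurrent edge leaves an output gate. -/
  recIn_ne : ∀ j k, recIn j ≠ C.outGate k
  recAux_ne : ∀ j k, recAux j ≠ C.outGate k
  /-- Number of halting gates. -/
  numHalt : ℕ
  /-- The halting gates, in order. -/
  haltGate : Fin numHalt ↪ C.Gate
  /-- The halting function; its first argument, the number of the iteration, is positive. -/
  halt : ℕ → (Fin numHalt → ℝ) → Bool

namespace RecCircuit

variable {n : ℕ} (R : RecCircuit n)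

/-- The new values of the memory gates after one iteration of the underlying circuit. -/
def step (s : (Fin n → ℝ) × (Fin R.aux → ℝ)) : (Fin n → ℝ) × (Fin R.aux → ℝ) :=
  (fun j => R.C.val s.1 s.2 (R.recIn j), fun j => R.C.val s.1 s.2 (R.recAux j))

/-- The values of the memory gates at the beginning of iteration `k + 1`. -/
def state (x : Fin n → ℝ) (k : ℕ) : (Fin n → ℝ) × (Fin R.aux → ℝ) :=
  R.step^[k] (x, R.init)

/-- Whether the circuit may halt in iteration `k + 1`. -/
def haltsAt (x : Fin n → ℝ) (k : ℕ) : Bool :=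
  R.halt (k + 1) fun j => R.C.val (R.state x k).1 (R.state x k).2 (R.haltGate j)

/-- The partial function computed by the recurrent circuit: the output of the first iteration in
which the halting function is `1`, and undefined if there is none. -/
def eval (x : Fin n → ℝ) : Part (Fin R.out → ℝ) :=
  (Nat.rfind fun k => Part.some (R.haltsAt x k)).map fun k =>
    R.C.eval (R.state x k).1 (R.state x k).2

end RecCircuit

/-- A family of recurrent arithmetic circuits, the `n`-th one having `n` inputs. -/
abbrev RecFamily : Type 1 := ∀ n, RecCircuit n

/-- The underlying family of extended arithmetic circuits. -/
def RecFamily.underlying (R : RecFamily) : ExtFamily :=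
  ⟨fun n => (R n).aux, fun n => (R n).out, fun n => (R n).C⟩

/-- The partial function `ℝ* → ℝ*` computed by a recurrent circuit family. -/
def RecFamily.eval (R : RecFamily) : List ℝ → Part (List ℝ) := fun x =>
  ((R x.length).eval x.get).map List.ofFn

/-- The halting functions of `R` are among the functions computed by an `𝔉`-circuit family `H`: a
halting function with `p` real arguments is computed by the member of `H` with `p + 1` inputs,
the first of which is the number of the iteration. -/
def RecFamily.HaltsIn (R : RecFamily) (𝔉 : CircuitClass) : Prop :=
  ∃ H : ∀ k, ExtCircuit k 0 1,
    ExtFamily.IsFamilyOf ⟨fun _ => 0, fun _ => 1, H⟩ 𝔉 ∧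
    ∀ (n i : ℕ) (v : Fin (R n).numHalt → ℝ), 1 ≤ i →
      (H ((R n).numHalt + 1)).eval (Fin.cons (i : ℝ) v) Fin.elim0 0 =
        if (R n).halt i v then 1 else 0

/-- The recurrent circuit function class `rec[𝔉halt]-𝔉`. -/
def RecClass (𝔉halt 𝔉 : CircuitClass) : Set (List ℝ → Part (List ℝ)) :=
  {f | ∃ R : RecFamily, R.underlying.IsFamilyOf 𝔉 ∧ R.HaltsIn 𝔉halt ∧ f = R.eval}

/-- Invariance under permutations of all arguments but the first. -/
def TailSymmetric {β : Type} (f : List ℝ → Part β) : Prop :=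
  ∀ (x : ℝ) (l l' : List ℝ), l.Perm l' → f (x :: l) = f (x :: l')

/-- The tail-symmetric real-valued functions of the class `rec[𝔉halt]-𝔉`. -/
def TailRecClass (𝔉halt 𝔉 : CircuitClass) : Set (List ℝ → Part ℝ) :=
  {f | TailSymmetric f ∧ (fun x => (f x).map fun y => [y]) ∈ RecClass 𝔉halt 𝔉}

/-! ### Labelled graphs and recurrent circuit graph neural networks -/

/-- A finite undirected graph on an ordered set of vertices with real feature values. -/
structure LGraph where
  card : ℕ
  graph : SimpleGraph (Fin card)
  feat : Fin card → ℝ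

namespace LGraph

open Classical in
/-- The neighbours of `v`, in the order of the vertices. -/
def nbrs (G : LGraph) (v : Fin G.card) : List (Fin G.card) :=
  (List.finRange G.card).filter fun w => G.graph.Adj v w

open Classical in
/-- The encoding of a labelled graph: the entries of the adjacency matrix, row by row, followed by
the feature values. -/
def encode (G : LGraph) : List ℝ :=
  ((List.finRange G.card).flatMap fun v =>
    (List.finRange G.card).map fun w => if G.graph.Adj v w then (1 : ℝ) else 0) ++
  (List.finRange G.card).map G.feat

end LGraph

/-- A recurrent circuit graph neural network. The layer functions and activation functions are
assigned periodically, and the halting function is invariant under permutations of the features. -/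
structure RecCGNN where
  layer : ℕ → (List ℝ → Part ℝ)
  act : ℕ → ℝ → ℝ
  period : ℕ
  period_pos : 0 < period
  layer_periodic : Function.Periodic layer period
  act_periodic : Function.Periodic act period
  /-- The halting function; its first argument, the number of the layer, is positive. -/
  halt : ℕ → List ℝ → Bool
  halt_perm : ∀ (i : ℕ) (l l' : List ℝ), l.Perm l' → halt i l = halt i l'

namespace RecCGNN

variable (N : RecCGNN)

/-- One layer: the feature value of every vertex `v` is replaced by the activation function applied
to the layer function of the feature values of `v` and of its neighbours. The result is undefined
if the layer function is undefined at some vertex. -/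
def layerStep (G : LGraph) (i : ℕ) (h : Fin G.card → ℝ) : Part (Fin G.card → ℝ) where
  Dom := ∀ v, (N.layer i (h v :: (G.nbrs v).map h)).Dom
  get := fun hd v => N.act i ((N.layer i (h v :: (G.nbrs v).map h)).get (hd v))

/-- The feature values after `i` layers. -/
def feats (G : LGraph) : ℕ → Part (Fin G.card → ℝ)
  | 0 => Part.some G.feat
  | i + 1 => (feats G i).bind (N.layerStep G (i + 1))

/-- The partial function on labelled graphs computed by the network: the graph is unchanged, and
the features are those after the first layer at which the halting function is `1`. -/
def eval : LGraph → Part LGraph := fun G =>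
  (Nat.rfind fun k => (N.feats G (k + 1)).map fun h => N.halt (k + 1) (List.ofFn h)).bind fun k =>
    (N.feats G (k + 1)).map fun h => { G with feat := h }

/-- `N` is a `(rec[t𝔉_s]-t𝔉, A)`-GNN, i.e. a circuit graph neural network with inner recurrence
only: its layer functions are tail-symmetric functions of `rec[𝔉_s]-𝔉`, its activation functions
are in `A`, and it halts at a fixed layer. -/
def IsInnerRecurrent (𝔉 : CircuitClass) (A : Set (ℝ → ℝ)) : Prop :=
  (∀ i, N.layer i ∈ TailRecClass 𝔉.withSign 𝔉) ∧ (∀ i, N.act i ∈ A) ∧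
  ∃ d : ℕ, 1 ≤ d ∧ ∀ i l, N.halt i l = decide (i = d)

end RecCGNN

end RecGNN

end

/-!
A single recurrent circuit can run any finite family of recurrent circuits side by side. Their
memory gates become registers; besides these, each member of the family has a flag saying that it is
running, a counter for its own iterations, which is what its halting circuit has to see instead of
the global iteration number, and a flag that freezes its first output once it halts. A multiplexer
in front of each register loads the arguments when the member is started and feeds back its
recurrent edges afterwards.

For a network on graphs with `n` vertices the family has one member for each layer, vertex and
possible degree of the vertex: the degree is known only at run time, whereas the arity of a circuit
is fixed. All of them are run, and sign gates select the one for the actual degree. The `j`-th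
neighbour of `v` is found in constant depth as the neighbour of `v` preceded by exactly `j` others.
Layer `k + 1` is started once the selected circuits of layer `k` have halted at all vertices, so the
simulation halts if and only if every layer is defined at every vertex. Tuples that encode no graph
are read as directed graphs, which keeps total networks total.

Only polynomially many circuits of polynomial size are combined, by formulas of constant depth.
-/

noncomputable section

namespace RecGNN

/-! ### Arithmetic formulas -/

/-- The operation performed by a gate that is neither a memory gate nor an output gate. The
arguments of a sum or a product are indexed by a finite type, so that they may repeat, unlike the
predecessors of a gate. -/
inductive Op : Type 1
  | const (c : ℝ)
  | func (f : ℝ → ℝ)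
  | add (ι : Type) [Fintype ι]
  | mul (ι : Type) [Fintype ι]

namespace Op

/-- The index type of the arguments of an operation. -/
def Arity : Op → Type
  | const _ => Empty
  | func _ => Unit
  | add ι => ι
  | mul ι => ι

instance fintypeArity : (o : Op) → Fintype o.Arity
  | const _ => inferInstanceAs (Fintype Empty)
  | func _ => inferInstanceAs (Fintype Unit)
  | add ι => inferInstanceAs (Fintype ι)
  | mul ι => inferInstanceAs (Fintype ι)

/-- The result of an operation. -/
def eval : (o : Op) → (o.Arity → ℝ) → ℝ
  | const c, _ => c
  | func f, v => f (v ())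
  | add ι, v => ∑ i : ι, v i
  | mul ι, v => ∏ i : ι, v i

/-- The operation is not the application of a function outside `A`. -/
def UsesOnly (A : Set (ℝ → ℝ)) : Op → Prop
  | func f => f ∈ A
  | _ => True

variable {n ℓ m : ℕ} {Γ : Type}

open Classical in
/-- The label of a gate which applies an operation to the gates `e`; for a sum or a product it is
faithful only if the gates `e` are distinct. -/
def label : (o : Op) → (o.Arity → Γ) → GateLabel n ℓ m Γ
  | const c, _ => .const c
  | func f, e => .func f (e ())
  | add ι, e => .add (Finset.univ.image fun i : ι => e i)
  | mul ι, e => .mul (Finset.univ.image fun i : ι => e i)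

theorem mem_preds_label {o : Op} {e : o.Arity → Γ} {g : Γ} :
    g ∈ (o.label e : GateLabel n ℓ m Γ).preds ↔ ∃ i, e i = g := by
  cases o with
  | const c => exact ⟨fun h => (Finset.notMem_empty g h).elim, fun ⟨i, _⟩ => i.elim⟩
  | func f => exact Finset.mem_singleton.trans ⟨fun h => ⟨(), h.symm⟩, fun ⟨_, h⟩ => h.symm⟩
  | add ι =>
    simp only [label, GateLabel.preds, Finset.mem_image, Finset.mem_univ, true_and]
    rfl
  | mul ι =>
    simp only [label, GateLabel.preds, Finset.mem_image, Finset.mem_univ, true_and]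
    rfl

theorem apply_label {o : Op} {e : o.Arity → Γ} (he : Function.Injective e) (x : Fin n → ℝ)
    (a : Fin ℓ → ℝ) (v : Γ → ℝ) :
    (o.label e : GateLabel n ℓ m Γ).apply x a v = o.eval (v ∘ e) := by
  classical
  cases o with
  | add ι => exact Finset.sum_image he.injOn
  | mul ι => exact Finset.prod_image he.injOn
  | _ => rfl

theorem label_ne_input (o : Op) (e : o.Arity → Γ) (j : Fin n) :
    (o.label e : GateLabel n ℓ m Γ) ≠ .input j := by
  cases o <;> nofun

theorem label_ne_aux (o : Op) (e : o.Arity → Γ) (j : Fin ℓ) :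
    (o.label e : GateLabel n ℓ m Γ) ≠ .aux j := by
  cases o <;> nofun

theorem label_ne_output (o : Op) (e : o.Arity → Γ) (j : Fin m) (g : Γ) :
    (o.label e : GateLabel n ℓ m Γ) ≠ .output j g := by
  cases o <;> nofun

theorem UsesOnly.mem_of_label_eq_func {A : Set (ℝ → ℝ)} {o : Op} (ho : o.UsesOnly A)
    {e : o.Arity → Γ} {f : ℝ → ℝ} {g : Γ} (h : (o.label e : GateLabel n ℓ m Γ) = .func f g) :
    f ∈ A := by
  cases o <;> cases h
  exact ho

end Op

/-- Arithmetic formulas of unbounded fan-in with variables in `V`. -/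
inductive Formula (V : Type) : Type 1
  | var (v : V)
  | node (o : Op) (F : o.Arity → Formula V)

namespace Formula

variable {V V' : Type}

/-- The value of a formula under an assignment of its variables. -/
def eval (ρ : V → ℝ) : Formula V → ℝ
  | var v => ρ v
  | node o F => o.eval fun i => (F i).eval ρ

/-- The constant formula. -/
def const (c : ℝ) : Formula V := node (.const c) Empty.elim

/-- The application of a real function to a formula. -/
def func (f : ℝ → ℝ) (F : Formula V) : Formula V := node (.func f) fun _ => F

/-- The sum of a finite family of formulas. -/
def sum {ι : Type} [Fintype ι] (F : ι → Formula V) : Formula V := node (.add ι) F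

/-- The product of a finite family of formulas. -/
def prod {ι : Type} [Fintype ι] (F : ι → Formula V) : Formula V := node (.mul ι) F

instance : Add (Formula V) := ⟨fun F G => sum fun b => cond b F G⟩

instance : Mul (Formula V) := ⟨fun F G => prod fun b => cond b F G⟩

instance : Sub (Formula V) := ⟨fun F G => F + const (-1) * G⟩

section Eval

variable (ρ : V → ℝ)

@[simp] theorem eval_const (c : ℝ) : (const c).eval ρ = c := rfl

@[simp] theorem eval_func (f : ℝ → ℝ) (F : Formula V) : (func f F).eval ρ = f (F.eval ρ) := rfl

@[simp] theorem eval_sum {ι : Type} [Fintype ι] (F : ι → Formula V) :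
    (sum F).eval ρ = ∑ i, (F i).eval ρ := rfl

@[simp] theorem eval_add (F G : Formula V) : (F + G).eval ρ = F.eval ρ + G.eval ρ :=
  (Fintype.sum_bool fun b => (cond b F G).eval ρ)

@[simp] theorem eval_mul (F G : Formula V) : (F * G).eval ρ = F.eval ρ * G.eval ρ :=
  (Fintype.prod_bool fun b => (cond b F G).eval ρ)

@[simp] theorem eval_sub (F G : Formula V) : (F - G).eval ρ = F.eval ρ - G.eval ρ := by
  change (F + const (-1) * G).eval ρ = _
  rw [eval_add, eval_mul, eval_const, neg_one_mul, sub_eq_add_neg]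

end Eval

/-- The formula with its variables renamed by `e`. -/
def rename (e : V → V') : Formula V → Formula V'
  | var v => var (e v)
  | node o F => node o fun i => (F i).rename e

@[simp] theorem eval_rename (e : V → V') (ρ : V' → ℝ) (F : Formula V) :
    (F.rename e).eval ρ = F.eval (ρ ∘ e) := by
  induction F with
  | var v => rfl
  | node o F ih => exact congrArg o.eval (funext ih)

/-- The formula uses only functions in `A`, has fan-in at most `W + 2` and height at most `c`, and
its variables satisfy `P`. The fan-in `2` of sums and products of two formulas is always allowed. -/
inductive Bounded (A : Set (ℝ → ℝ)) (W : ℕ) (P : V → Prop) : ℕ → Formula V → Prop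
  | var {c : ℕ} {v : V} (h : P v) : Bounded A W P c (var v)
  | node {c : ℕ} {o : Op} {F : o.Arity → Formula V} (hA : o.UsesOnly A)
      (hW : Fintype.card o.Arity ≤ W + 2) (hF : ∀ i, Bounded A W P c (F i)) :
      Bounded A W P (c + 1) (node o F)

namespace Bounded

variable {A : Set (ℝ → ℝ)} {W c : ℕ} {P : V → Prop} {F G : Formula V}

theorem mono {W' c' : ℕ} {P' : V → Prop} (hW : W ≤ W') (hP : ∀ v, P v → P' v) (hc : c ≤ c')
    (hF : F.Bounded A W P c) : F.Bounded A W' P' c' := by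
  induction hF generalizing c' with
  | var h => exact .var (hP _ h)
  | node hA hW' _ ih =>
    obtain ⟨c', rfl⟩ := Nat.exists_eq_succ_of_ne_zero (Nat.ne_zero_of_lt hc)
    exact .node hA (by omega) fun i => ih i (Nat.le_of_succ_le_succ hc)

theorem of_le {c' : ℕ} (hF : F.Bounded A W P c) (hc : c ≤ c') : F.Bounded A W P c' :=
  hF.mono le_rfl (fun _ => id) hc

theorem rename {e : V → V'} {P' : V' → Prop} (he : ∀ v, P v → P' (e v))
    (hF : F.Bounded A W P c) : (F.rename e).Bounded A W P' c := by
  induction hF with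
  | var h => exact .var (he _ h)
  | node hA hW _ ih => exact .node hA hW ih

theorem const (r : ℝ) : (const r : Formula V).Bounded A W P (c + 1) :=
  .node trivial (Nat.zero_le _) nofun

theorem func {f : ℝ → ℝ} (hf : f ∈ A) (hF : F.Bounded A W P c) :
    (func f F).Bounded A W P (c + 1) :=
  .node hf (Nat.le_add_left 1 _) fun _ => hF

theorem sum {ι : Type} [Fintype ι] {F : ι → Formula V} (hW : Fintype.card ι ≤ W + 2)
    (hF : ∀ i, (F i).Bounded A W P c) : (sum F).Bounded A W P (c + 1) :=
  .node trivial hW hF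

theorem prod {ι : Type} [Fintype ι] {F : ι → Formula V} (hW : Fintype.card ι ≤ W + 2)
    (hF : ∀ i, (F i).Bounded A W P c) : (prod F).Bounded A W P (c + 1) :=
  .node trivial hW hF

theorem add (hF : F.Bounded A W P c) (hG : G.Bounded A W P c) : (F + G).Bounded A W P (c + 1) :=
  sum (Nat.le_add_left 2 _) fun b => by cases b <;> assumption

theorem mul (hF : F.Bounded A W P c) (hG : G.Bounded A W P c) : (F * G).Bounded A W P (c + 1) :=
  prod (Nat.le_add_left 2 _) fun b => by cases b <;> assumption

theorem sub (hF : F.Bounded A W P (c + 1)) (hG : G.Bounded A W P (c + 1)) :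
    (F - G).Bounded A W P (c + 3) :=
  (hF.of_le (Nat.le_succ _)).add ((const _).mul hG)

end Bounded

/-- The length of a longest branch. -/
def height : Formula V → ℕ
  | var _ => 0
  | node _ F => (Finset.univ.sup fun i => (F i).height) + 1

theorem height_lt_height_node {o : Op} (F : o.Arity → Formula V) (i : o.Arity) :
    (F i).height < (node o F).height :=
  Nat.lt_succ_of_le (Finset.le_sup (f := fun i => (F i).height) (Finset.mem_univ i))

theorem Bounded.height_le {A : Set (ℝ → ℝ)} {W c : ℕ} {P : V → Prop} {F : Formula V}
    (hF : F.Bounded A W P c) : F.height ≤ c := by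
  induction hF with
  | var _ => exact Nat.zero_le _
  | node _ _ _ ih => exact Nat.succ_le_succ (Finset.sup_le fun i _ => ih i)

/-- The positions (nodes of the tree) of a formula. -/
def Pos : Formula V → Type
  | var _ => Unit
  | node _ F => Option (Σ i, (F i).Pos)

instance fintypePos : (F : Formula V) → Fintype F.Pos
  | var _ => inferInstanceAs (Fintype Unit)
  | node _ F =>
    letI := fun i => fintypePos (F i)
    inferInstanceAs (Fintype (Option (Σ i, (F i).Pos)))

/-- The position of the whole formula. -/
def root : (F : Formula V) → F.Pos
  | var _ => ()
  | node _ _ => none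

/-- The subformula at a position. -/
def subformula : (F : Formula V) → F.Pos → Formula V
  | var v, _ => var v
  | node o F, none => node o F
  | node _ F, some ⟨i, p⟩ => (F i).subformula p

@[simp] theorem subformula_root (F : Formula V) : F.subformula F.root = F := by
  cases F <;> rfl

theorem height_subformula_le (F : Formula V) (p : F.Pos) : (F.subformula p).height ≤ F.height := by
  induction F with
  | var v => exact le_rfl
  | node o F ih =>
    rcases p with - | ⟨i, p⟩
    · exact le_rfl
    · exact (ih i p).trans (height_lt_height_node F i).le

theorem Bounded.card_pos_le {A : Set (ℝ → ℝ)} {W c : ℕ} {P : V → Prop} {F : Formula V}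
    (hF : F.Bounded A W P c) : Fintype.card F.Pos ≤ (W + 3) ^ c := by
  induction hF with
  | var _ => exact Nat.one_le_pow _ _ (by omega)
  | @node c o F _ hW _ ih =>
    calc Fintype.card (Option (Σ i, (F i).Pos))
      _ = ∑ i, Fintype.card (F i).Pos + 1 := by rw [Fintype.card_option, Fintype.card_sigma]
      _ ≤ Fintype.card o.Arity * (W + 3) ^ c + (W + 3) ^ c :=
        Nat.add_le_add (Finset.sum_le_card_nsmul _ _ _ fun i _ => ih i)
          (Nat.one_le_pow _ _ (by omega))
      _ ≤ (W + 2) * (W + 3) ^ c + (W + 3) ^ c := by gcongr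
      _ = (W + 3) ^ (c + 1) := by ring

/-- An operation together with references to its arguments. -/
structure Instr (Γ : Type) : Type 1 where
  op : Op
  args : op.Arity → Γ

/-- The operation at a position; its arguments are positions, or a variable at a leaf. The leaf is a
sum with one summand, so that every occurrence of a variable has a gate of its own. -/
def instr : (F : Formula V) → F.Pos → Instr (V ⊕ F.Pos)
  | var v, _ => ⟨.add Unit, fun _ => .inl v⟩
  | node o F, none => ⟨o, fun i => .inr (some ⟨i, (F i).root⟩)⟩
  | node _ F, some ⟨i, p⟩ =>
    ⟨((F i).instr p).op, fun j => (((F i).instr p).args j).map id fun q => some ⟨i, q⟩⟩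

theorem height_lt_of_instr_args_eq {F : Formula V} {p q : F.Pos} {j : (F.instr p).op.Arity}
    (h : (F.instr p).args j = .inr q) : (F.subformula q).height < (F.subformula p).height := by
  induction F with
  | var v => cases h
  | node o F ih =>
    rcases p with - | ⟨i, p⟩
    · cases h
      exact (congrArg height (subformula_root _)).trans_lt (height_lt_height_node F j)
    · change Sum.map _ _ (((F i).instr p).args j) = _ at h
      cases hq : ((F i).instr p).args j with
      | inl _ =>
        rw [hq] at h
        cases h
      | inr _ =>
        rw [hq] at h
        cases h
        exact ih i hq

theorem Bounded.of_instr_args_eq {A : Set (ℝ → ℝ)} {W c : ℕ} {P : V → Prop} {F : Formula V}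
    (hF : F.Bounded A W P c) {p : F.Pos} {j : (F.instr p).op.Arity} {v : V}
    (h : (F.instr p).args j = .inl v) : P v := by
  induction hF with
  | var hv =>
    cases h
    exact hv
  | @node _ _ F _ _ _ ih =>
    rcases p with - | ⟨i, p⟩
    · cases h
    · change Sum.map _ _ (((F i).instr p).args j) = _ at h
      cases hq : ((F i).instr p).args j with
      | inl _ =>
        rw [hq] at h
        cases h
        exact ih i hq
      | inr _ =>
        rw [hq] at h
        cases h

theorem Bounded.usesOnly_instr {A : Set (ℝ → ℝ)} {W c : ℕ} {P : V → Prop} {F : Formula V}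
    (hF : F.Bounded A W P c) (p : F.Pos) : (F.instr p).op.UsesOnly A := by
  induction hF with
  | var _ => trivial
  | node hA _ _ ih =>
    rcases p with - | ⟨i, p⟩
    · exact hA
    · exact ih i p

theorem injective_comp_instr_args {F : Formula V} {Γ : Type} {e : V ⊕ F.Pos → Γ}
    (he : Function.Injective (e ∘ Sum.inr)) (p : F.Pos) :
    Function.Injective (e ∘ (F.instr p).args) := by
  induction F with
  | var v => exact fun _ _ _ => rfl
  | node o F ih =>
    rcases p with - | ⟨i, p⟩
    · exact fun i j h => congrArg Sigma.fst (Option.some.inj (he h))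
    · refine ih i (e := e ∘ Sum.map id fun q => some ⟨i, q⟩) (fun q r h => ?_) p
      exact eq_of_heq (Sigma.mk.inj (Option.some.inj (he h))).2

theorem eval_instr (ρ : V → ℝ) (F : Formula V) (p : F.Pos) :
    (F.instr p).op.eval (fun j => Sum.elim ρ (fun q => (F.subformula q).eval ρ)
      ((F.instr p).args j)) = (F.subformula p).eval ρ := by
  induction F with
  | var v => exact Fintype.sum_unique _
  | node o F ih =>
    rcases p with - | ⟨i, p⟩
    · exact congrArg o.eval (funext fun i => congrArg (eval ρ) (subformula_root (F i)))
    · refine Eq.trans (congrArg ((F i).instr p).op.eval (funext fun j => ?_)) (ih i p)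
      change Sum.elim _ _ (Sum.map _ _ (((F i).instr p).args j)) = _
      cases ((F i).instr p).args j <;> rfl

end Formula

/-! ### Circuits evaluating systems of formulas -/

namespace ExtCircuit

variable {n ℓ m : ℕ} (C : ExtCircuit n ℓ m)

theorem eq_val {x : Fin n → ℝ} {a : Fin ℓ → ℝ} {w : C.Gate → ℝ}
    (hw : ∀ g, w g = (C.label g).apply x a w) : w = C.val x a := by
  funext g
  induction g using C.acyclic.induction with
  | _ g ih =>
    rw [hw, C.val_eq]
    exact GateLabel.apply_congr x a _ ih

theorem level_le {r : C.Gate → ℕ} (hr : ∀ g h, g ∈ (C.label h).preds → r g < r h) (g : C.Gate) :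
    C.level g ≤ r g := by
  induction g using C.acyclic.induction with
  | _ g ih =>
    rw [C.level_eq]
    exact Finset.sup_le fun h hh => (Nat.succ_le_succ (ih h hh)).trans (hr h g hh)

theorem level_lt {g h : C.Gate} (hg : g ∈ (C.label h).preds) : C.level g < C.level h := by
  rw [C.level_eq h]
  exact Nat.lt_of_succ_le (Finset.le_sup (f := fun h => C.level h + 1) hg)

theorem level_le_depth (g : C.Gate) : C.level g ≤ C.depth := Finset.le_sup (Finset.mem_univ g)

theorem auxGate_injective : Function.Injective C.auxGate := fun i j hij => by
  have hi := (C.label_aux _ i).2 rfl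
  rw [hij, (C.label_aux _ j).2 rfl] at hi
  cases hi
  rfl

theorem aux_le_size : ℓ ≤ C.size := by
  simpa only [size, Fintype.card_fin] using Fintype.card_le_of_injective _ C.auxGate_injective

end ExtCircuit

/-- A system of formulas, one for each wire, which refer to input gates, auxiliary memory gates and
other wires; the outputs are the values of selected wires. The levels witness that the system is
acyclic. -/
structure Netlist (n ℓ m : ℕ) where
  Wire : Type
  fintypeWire : Fintype Wire
  form : Wire → Formula (Fin n ⊕ Fin ℓ ⊕ Wire)
  lev : Wire → ℕ
  out : Fin m → Wire

attribute [instance] Netlist.fintypeWire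

namespace Netlist

variable {n ℓ m : ℕ}

/-- The formula of the wire `g` may refer to memory gates and to wires of a lower level. -/
def Lower (S : Netlist n ℓ m) (g : S.Wire) : Fin n ⊕ Fin ℓ ⊕ S.Wire → Prop
  | .inr (.inr h) => S.lev h < S.lev g
  | _ => True

/-- The formulas of the system use only functions in `A`, have fan-in at most `W + 2`, height at
most `c`, and refer to lower wires only; there are at most `D + 1` levels. -/
structure Bounded (S : Netlist n ℓ m) (A : Set (ℝ → ℝ)) (W c D : ℕ) : Prop where
  form : ∀ g, (S.form g).Bounded A W (S.Lower g) c
  lev_le : ∀ g, S.lev g ≤ D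

/-- The gates of the circuit of a system: memory gates, output gates, and for each position of a
formula a gate performing its operation followed by a gate copying the result. Only the copy is
read by other gates, so that function gates have outdegree one. -/
inductive Gate (S : Netlist n ℓ m) : Type
  | input (j : Fin n)
  | aux (j : Fin ℓ)
  | core (g : S.Wire) (p : (S.form g).Pos)
  | copy (g : S.Wire) (p : (S.form g).Pos)
  | output (j : Fin m)

/-- The gates as a sum of finite types. -/
def gateEquiv (S : Netlist n ℓ m) :
    Fin n ⊕ Fin ℓ ⊕ Fin m ⊕ (Σ g, (S.form g).Pos) ⊕ (Σ g, (S.form g).Pos) ≃ S.Gate where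
  toFun
    | .inl j => .input j
    | .inr (.inl j) => .aux j
    | .inr (.inr (.inl j)) => .output j
    | .inr (.inr (.inr (.inl ⟨g, p⟩))) => .core g p
    | .inr (.inr (.inr (.inr ⟨g, p⟩))) => .copy g p
  invFun
    | .input j => .inl j
    | .aux j => .inr (.inl j)
    | .output j => .inr (.inr (.inl j))
    | .core g p => .inr (.inr (.inr (.inl ⟨g, p⟩)))
    | .copy g p => .inr (.inr (.inr (.inr ⟨g, p⟩)))
  left_inv := by rintro (_ | _ | _ | _ | _) <;> rfl
  right_inv := by rintro (_ | _ | _ | _ | _) <;> rfl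

instance (S : Netlist n ℓ m) : Fintype S.Gate := Fintype.ofEquiv _ S.gateEquiv

variable (S : Netlist n ℓ m)

/-- The gate carrying the value of a wire. -/
def wireGate (g : S.Wire) : S.Gate := .copy g (S.form g).root

/-- The gate carrying the value of a variable. -/
def varGate : Fin n ⊕ Fin ℓ ⊕ S.Wire → S.Gate
  | .inl j => .input j
  | .inr (.inl j) => .aux j
  | .inr (.inr g) => S.wireGate g

/-- The gate referred to by an argument of an operation in the formula of the wire `g`. -/
def argGate (g : S.Wire) : (Fin n ⊕ Fin ℓ ⊕ S.Wire) ⊕ (S.form g).Pos → S.Gate :=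
  Sum.elim S.varGate (Gate.copy g)

theorem argGate_ne_core {g g' : S.Wire} (r : (Fin n ⊕ Fin ℓ ⊕ S.Wire) ⊕ (S.form g).Pos)
    (p : (S.form g').Pos) : S.argGate g r ≠ .core g' p := by
  rcases r with (_ | _ | _) | _ <;> nofun

theorem argGate_ne_output {g : S.Wire} (r : (Fin n ⊕ Fin ℓ ⊕ S.Wire) ⊕ (S.form g).Pos)
    (j : Fin m) : S.argGate g r ≠ .output j := by
  rcases r with (_ | _ | _) | _ <;> nofun

theorem copy_injective (g : S.Wire) : Function.Injective (Gate.copy g) := fun p q h => by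
  cases h
  rfl

theorem argGate_args_injective (g : S.Wire) (p : (S.form g).Pos) :
    Function.Injective (S.argGate g ∘ ((S.form g).instr p).args) :=
  Formula.injective_comp_instr_args (e := S.argGate g) (S.copy_injective g) p

/-- The labels of the gates of the circuit of a system. -/
def label : S.Gate → GateLabel n ℓ m S.Gate
  | .input j => .input j
  | .aux j => .aux j
  | .core g p => ((S.form g).instr p).op.label (S.argGate g ∘ ((S.form g).instr p).args)
  | .copy g p => .add {.core g p}
  | .output j => .output j (S.wireGate (S.out j))

/-- A function on the gates which increases along the edges of the circuit of a system, provided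
that the formulas have height at most `c` and that there are at most `D + 1` levels. -/
def rank (c D : ℕ) : S.Gate → ℕ
  | .input _ => 0
  | .aux _ => 0
  | .core g p => S.lev g * (2 * c + 2) + 2 * ((S.form g).subformula p).height + 1
  | .copy g p => S.lev g * (2 * c + 2) + 2 * ((S.form g).subformula p).height + 2
  | .output _ => (D + 1) * (2 * c + 2) + 1

theorem label_eq_input_iff {x : S.Gate} {j : Fin n} : S.label x = .input j ↔ x = .input j := by
  rcases x with _ | _ | ⟨g, p⟩ | _ | _
  case core => exact iff_of_false (Op.label_ne_input _ _ _) nofun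
  all_goals simp [label]

theorem label_eq_aux_iff {x : S.Gate} {j : Fin ℓ} : S.label x = .aux j ↔ x = .aux j := by
  rcases x with _ | _ | ⟨g, p⟩ | _ | _
  case core => exact iff_of_false (Op.label_ne_aux _ _ _) nofun
  all_goals simp [label]

theorem exists_label_eq_output_iff {x : S.Gate} {j : Fin m} :
    (∃ h, S.label x = .output j h) ↔ x = .output j := by
  rcases x with _ | _ | ⟨g, p⟩ | _ | _
  case core => exact iff_of_false (fun ⟨_, h⟩ => Op.label_ne_output _ _ _ _ h) nofun
  all_goals simp [label]

theorem output_notMem_preds_label (j : Fin m) (x : S.Gate) : .output j ∉ (S.label x).preds := by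
  intro h
  cases x with
  | input _ | aux _ => cases h
  | core g p =>
    obtain ⟨i, hi⟩ := Op.mem_preds_label.1 h
    exact S.argGate_ne_output _ j hi
  | copy g p | output j => cases Finset.mem_singleton.1 h

theorem core_mem_preds_label_iff {g : S.Wire} {p : (S.form g).Pos} {x : S.Gate} :
    .core g p ∈ (S.label x).preds ↔ x = .copy g p := by
  refine ⟨fun h => ?_, by rintro rfl; exact Finset.mem_singleton_self _⟩
  cases x with
  | input _ | aux _ => cases h
  | core g' p' =>
    obtain ⟨i, hi⟩ := Op.mem_preds_label.1 h
    exact (S.argGate_ne_core _ p hi).elim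
  | copy g' p' =>
    cases Finset.mem_singleton.1 h
    rfl
  | output j => cases Finset.mem_singleton.1 h

variable {S} {A : Set (ℝ → ℝ)} {W c D : ℕ}

theorem Bounded.rank_copy_le (hS : S.Bounded A W c D) (g : S.Wire) (p : (S.form g).Pos) :
    S.rank c D (.copy g p) ≤ (S.lev g + 1) * (2 * c + 2) := by
  have hp : ((S.form g).subformula p).height ≤ c :=
    ((S.form g).height_subformula_le p).trans (hS.form g).height_le
  rw [rank, add_one_mul]
  omega

theorem Bounded.rank_argGate_lt (hS : S.Bounded A W c D) {g : S.Wire} {p : (S.form g).Pos}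
    (i : ((S.form g).instr p).op.Arity) :
    S.rank c D (S.argGate g (((S.form g).instr p).args i)) < S.rank c D (.core g p) := by
  cases hr : ((S.form g).instr p).args i with
  | inl v =>
    have hv : S.Lower g v := (hS.form g).of_instr_args_eq hr
    rcases v with j | j | g'
    · exact Nat.succ_pos _
    · exact Nat.succ_pos _
    · calc S.rank c D (S.wireGate g')
        _ ≤ (S.lev g' + 1) * (2 * c + 2) := hS.rank_copy_le g' _
        _ ≤ S.lev g * (2 * c + 2) := Nat.mul_le_mul_right _ hv
        _ < S.rank c D (.core g p) := by
          rw [rank]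
          omega
  | inr q =>
    have hq := Formula.height_lt_of_instr_args_eq hr
    change S.rank c D (.copy g q) < _
    rw [rank, rank]
    omega

theorem Bounded.rank_lt (hS : S.Bounded A W c D) {x y : S.Gate} (h : x ∈ (S.label y).preds) :
    S.rank c D x < S.rank c D y := by
  cases y with
  | input _ | aux _ => cases h
  | core g p =>
    obtain ⟨i, rfl⟩ := Op.mem_preds_label.1 h
    exact hS.rank_argGate_lt i
  | copy g p =>
    obtain rfl := Finset.mem_singleton.1 h
    exact Nat.lt_succ_self _
  | output j =>
    obtain rfl := Finset.mem_singleton.1 h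
    exact Nat.lt_succ_of_le <| (hS.rank_copy_le _ _).trans <|
      Nat.mul_le_mul_right _ (Nat.succ_le_succ (hS.lev_le _))

/-- The circuit evaluating a system of formulas. -/
def Bounded.toCircuit (hS : S.Bounded A W c D) : ExtCircuit n ℓ m where
  Gate := S.Gate
  fintypeGate := inferInstance
  label := S.label
  acyclic := Subrelation.wf (fun h => hS.rank_lt h) (measure (S.rank c D)).wf
  inGate := .input
  auxGate := .aux
  outGate := .output
  label_input _ _ := S.label_eq_input_iff
  label_aux _ _ := S.label_eq_aux_iff
  label_output _ _ := S.exists_label_eq_output_iff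
  outGate_fanout := S.output_notMem_preds_label
  func_fanout x f h hx := by
    cases x with
    | core g p => exact ⟨.copy g p, S.core_mem_preds_label_iff.2 rfl,
        fun _ => S.core_mem_preds_label_iff.1⟩
    | _ => cases hx

section Circuit

variable (hS : S.Bounded A W c D)

include hS

theorem Bounded.usesOnly_toCircuit : hS.toCircuit.UsesOnly A := by
  intro x f h hx
  cases x with
  | core g p => exact ((hS.form g).usesOnly_instr p).mem_of_label_eq_func hx
  | _ => cases hx

theorem Bounded.rank_le (x : S.Gate) : S.rank c D x ≤ (D + 1) * (2 * c + 2) + 1 := by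
  have hcopy (g : S.Wire) (p : (S.form g).Pos) : S.rank c D (.copy g p) ≤ (D + 1) * (2 * c + 2) :=
    (hS.rank_copy_le g p).trans (Nat.mul_le_mul_right _ (Nat.succ_le_succ (hS.lev_le g)))
  cases x with
  | input _ | aux _ => exact Nat.zero_le _
  | core g p => exact (Nat.le_succ _).trans (Nat.le_succ_of_le (hcopy g p))
  | copy g p => exact Nat.le_succ_of_le (hcopy g p)
  | output j => exact le_rfl

theorem Bounded.depth_toCircuit_le : hS.toCircuit.depth ≤ (D + 1) * (2 * c + 2) + 1 :=
  Finset.sup_le fun x _ =>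
    (hS.toCircuit.level_le (fun _ _ h => hS.rank_lt h) x).trans (hS.rank_le x)

theorem Bounded.size_toCircuit_le :
    hS.toCircuit.size ≤ n + ℓ + m + Fintype.card S.Wire * (2 * (W + 3) ^ c) := by
  have hsize : hS.toCircuit.size =
      n + (ℓ + (m + (∑ g, Fintype.card (S.form g).Pos + ∑ g, Fintype.card (S.form g).Pos))) := by
    refine (Fintype.card_congr S.gateEquiv.symm).trans ?_
    simp only [Fintype.card_sum, Fintype.card_sigma, Fintype.card_fin]
  have hpos : ∑ g, Fintype.card (S.form g).Pos ≤ Fintype.card S.Wire * (W + 3) ^ c :=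
    Finset.sum_le_card_nsmul _ _ _ fun g _ => (hS.form g).card_pos_le
  rw [hsize, Nat.mul_left_comm]
  omega

theorem Bounded.val_toCircuit {x : Fin n → ℝ} {a : Fin ℓ → ℝ} {w : S.Wire → ℝ}
    (hw : ∀ g, w g = (S.form g).eval (Sum.elim x (Sum.elim a w))) (g : S.Wire) :
    hS.toCircuit.val x a (S.wireGate g) = w g := by
  let ρ := Sum.elim x (Sum.elim a w)
  let u : S.Gate → ℝ
    | .input j => x j
    | .aux j => a j
    | .core g p => ((S.form g).subformula p).eval ρ
    | .copy g p => ((S.form g).subformula p).eval ρ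
    | .output j => w (S.out j)
  have u_wireGate (g : S.Wire) : u (S.wireGate g) = w g :=
    (congrArg (Formula.eval ρ) (S.form g).subformula_root).trans (hw g).symm
  have u_argGate (g : S.Wire) (r) :
      u (S.argGate g r) = Sum.elim ρ (fun q => ((S.form g).subformula q).eval ρ) r := by
    rcases r with (j | j | g') | q
    · rfl
    · rfl
    · exact u_wireGate g'
    · rfl
  have hu : u = hS.toCircuit.val x a := hS.toCircuit.eq_val fun y => by
    cases y with
    | input _ | aux _ => rfl
    | core g p =>
      refine ((S.form g).eval_instr ρ p).symm.trans (Eq.symm ?_)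
      refine (Op.apply_label (S.argGate_args_injective g p) x a u).trans ?_
      exact congrArg ((S.form g).instr p).op.eval (funext fun i => u_argGate g _)
    | copy g p => exact (Finset.sum_singleton u (.core g p)).symm
    | output j => exact (u_wireGate _).symm
  rw [← hu, u_wireGate]

theorem Bounded.val_toCircuit_input (x : Fin n → ℝ) (a : Fin ℓ → ℝ) (j : Fin n) :
    hS.toCircuit.val x a (Gate.input j) = x j :=
  hS.toCircuit.val_eq x a _

theorem Bounded.eval_toCircuit {x : Fin n → ℝ} {a : Fin ℓ → ℝ} {w : S.Wire → ℝ}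
    (hw : ∀ g, w g = (S.form g).eval (Sum.elim x (Sum.elim a w))) (j : Fin m) :
    hS.toCircuit.eval x a j = w (S.out j) := by
  rw [← hS.val_toCircuit hw]
  exact hS.toCircuit.val_eq x a _

end Circuit

end Netlist

namespace GateLabel

variable {n ℓ m : ℕ} {γ V : Type}

/-- The formula of a gate of a circuit, where the memory gates are replaced by formulas and the
values of the gates are the variables given by `e`. -/
def toFormula (inF : Fin n → Formula V) (auxF : Fin ℓ → Formula V) (e : γ → V) :
    GateLabel n ℓ m γ → Formula V
  | input j => inF j
  | aux j => auxF j
  | const c => .const c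
  | add s => .sum fun i : s => .var (e i)
  | mul s => .prod fun i : s => .var (e i)
  | func f h => .func f (.var (e h))
  | output _ h => .var (e h)

theorem eval_toFormula (inF : Fin n → Formula V) (auxF : Fin ℓ → Formula V) (e : γ → V)
    (ρ : V → ℝ) (L : GateLabel n ℓ m γ) :
    (L.toFormula inF auxF e).eval ρ =
      L.apply (fun j => (inF j).eval ρ) (fun j => (auxF j).eval ρ) (ρ ∘ e) := by
  cases L with
  | add s => exact Finset.sum_coe_sort s (ρ ∘ e)
  | mul s => exact Finset.prod_coe_sort s (ρ ∘ e)
  | _ => rfl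

theorem bounded_toFormula {A : Set (ℝ → ℝ)} {W : ℕ} {P : V → Prop} {inF : Fin n → Formula V}
    {auxF : Fin ℓ → Formula V} {e : γ → V} {L : GateLabel n ℓ m γ}
    (hin : ∀ j, (inF j).Bounded A W P 1) (haux : ∀ j, (auxF j).Bounded A W P 1)
    (hW : L.preds.card ≤ W + 2) (hP : ∀ g ∈ L.preds, P (e g)) (hA : ∀ f p, L = .func f p → f ∈ A) :
    (L.toFormula inF auxF e).Bounded A W P 1 := by
  cases L with
  | input j => exact hin j
  | aux j => exact haux j
  | const c => exact .const c
  | add s => exact .sum ((Fintype.card_coe s).trans_le hW) fun i => .var (hP i i.2)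
  | mul s => exact .prod ((Fintype.card_coe s).trans_le hW) fun i => .var (hP i i.2)
  | func f h => exact .func (hA f h rfl) (.var (hP h (Finset.mem_singleton_self h)))
  | output j h => exact .var (hP h (Finset.mem_singleton_self h))

end GateLabel

/-! ### Running recurrent circuits inside a recurrent circuit -/

namespace RecCircuit

variable {n : ℕ} (R : RecCircuit n)

theorem state_succ (x : Fin n → ℝ) (k : ℕ) : R.state x (k + 1) = R.step (R.state x k) :=
  Function.iterate_succ_apply' _ _ _

theorem dom_eval_iff {x : Fin n → ℝ} : (R.eval x).Dom ↔ ∃ k, R.haltsAt x k = true :=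
  Nat.rfind_dom.trans ⟨fun ⟨k, hk, _⟩ => ⟨k, (Part.mem_some_iff.1 hk).symm⟩,
    fun ⟨k, hk⟩ => ⟨k, Part.mem_some_iff.2 hk.symm, fun _ => trivial⟩⟩

theorem mem_eval_iff {x : Fin n → ℝ} {y : Fin R.out → ℝ} :
    y ∈ R.eval x ↔ ∃ k, R.haltsAt x k = true ∧ (∀ k' < k, R.haltsAt x k' = false) ∧
      R.C.eval (R.state x k).1 (R.state x k).2 = y := by
  refine (Part.mem_map_iff _).trans (exists_congr fun k => ?_)
  refine (and_congr_left' Nat.mem_rfind).trans (and_assoc.trans ?_)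
  exact and_congr (Part.mem_some_iff.trans eq_comm) <| and_congr_left' <|
    forall₂_congr fun _ _ => Part.mem_some_iff.trans eq_comm

end RecCircuit

/-- The multiplexer: `a` if `r = 1`, and `b` if `r = 0`. -/
def mux (r a b : ℝ) : ℝ := r * a + (1 - r) * b

@[simp] theorem mux_zero (a b : ℝ) : mux 0 a b = b := by simp [mux]

@[simp] theorem mux_one (a b : ℝ) : mux 1 a b = a := by simp [mux]

namespace Formula

variable {V : Type}

/-- The formula for `RecGNN.mux`. -/
def mux (R F G : Formula V) : Formula V := R * F + (const 1 - R) * G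

@[simp] theorem eval_mux (ρ : V → ℝ) (R F G : Formula V) :
    (mux R F G).eval ρ = RecGNN.mux (R.eval ρ) (F.eval ρ) (G.eval ρ) := by
  simp only [mux, RecGNN.mux, eval_add, eval_mul, eval_sub, eval_const]

theorem Bounded.mux {A : Set (ℝ → ℝ)} {W c : ℕ} {P : V → Prop} {R F G : Formula V}
    (hR : R.Bounded A W P (c + 1)) (hF : F.Bounded A W P (c + 3)) (hG : G.Bounded A W P (c + 3)) :
    (mux R F G).Bounded A W P (c + 5) :=
  ((hR.of_le (by omega)).mul hF).add (((Bounded.const 1).sub hR).mul hG)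

end Formula

/-- The signal `r` changes from `0` to `1` at time `T`. -/
def FiresAt (r : ℕ → ℝ) (T : ℕ) : Prop := ∀ t, r t = if T ≤ t then 1 else 0

namespace FiresAt

variable {r : ℕ → ℝ} {T t : ℕ}

theorem eq_one (h : FiresAt r T) (ht : T ≤ t) : r t = 1 := (h t).trans (if_pos ht)

theorem eq_zero (h : FiresAt r T) (ht : t < T) : r t = 0 := (h t).trans (if_neg ht.not_ge)

theorem prod {ι : Type} [Fintype ι] {r : ι → ℕ → ℝ} {T : ι → ℕ} (h : ∀ i, FiresAt (r i) (T i)) :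
    FiresAt (fun t => ∏ i, r i t) (Finset.univ.sup T) := fun t => by
  split_ifs with ht
  · exact Finset.prod_eq_one fun i hi => (h i).eq_one ((Finset.le_sup hi).trans ht)
  · simp only [Finset.sup_le_iff, not_forall, not_le] at ht
    obtain ⟨i, hi, hlt⟩ := ht
    exact Finset.prod_eq_zero hi ((h i).eq_zero hlt)

end FiresAt

/-- The first entry of a tuple, and zero if there is none. -/
def fstOrZero {k : ℕ} (y : Fin k → ℝ) : ℝ := if h : 0 < k then y ⟨0, h⟩ else 0

theorem headI_ofFn {k : ℕ} (y : Fin k → ℝ) : (List.ofFn y).headI = fstOrZero y := by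
  cases k with
  | zero => rfl
  | succ k => rw [List.ofFn_succ]; rfl

/-- A finite family of recurrent circuits together with circuits for their halting functions. -/
structure Bank where
  Index : Type
  fintypeIndex : Fintype Index
  arity : Index → ℕ
  circ : ∀ i, RecCircuit (arity i)
  haltCirc : ∀ i, ExtCircuit ((circ i).numHalt + 1) 0 1
  eval_haltCirc : ∀ (i : Index) (k : ℕ) (v : Fin (circ i).numHalt → ℝ), 1 ≤ k →
    (haltCirc i).eval (Fin.cons (k : ℝ) v) Fin.elim0 0 = if (circ i).halt k v then 1 else 0

attribute [instance] Bank.fintypeIndex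

namespace Bank

variable (B : Bank)

/-- The registers for the simulation of the circuits of a bank. For each circuit there are copies of
its input and auxiliary memory gates, the number of the current iteration, the flags "running" and
"finished", and the result. -/
inductive Reg : Type
  | arg (i : B.Index) (j : Fin (B.arity i))
  | aux (i : B.Index) (j : Fin (B.circ i).aux)
  | cnt (i : B.Index)
  | run (i : B.Index)
  | done (i : B.Index)
  | res (i : B.Index)

/-- The registers as a sum of finite types. -/
def regEquiv : (Σ i, Fin (B.arity i)) ⊕ (Σ i, Fin (B.circ i).aux) ⊕
    B.Index ⊕ B.Index ⊕ B.Index ⊕ B.Index ≃ B.Reg where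
  toFun
    | .inl ⟨i, j⟩ => .arg i j
    | .inr (.inl ⟨i, j⟩) => .aux i j
    | .inr (.inr (.inl i)) => .cnt i
    | .inr (.inr (.inr (.inl i))) => .run i
    | .inr (.inr (.inr (.inr (.inl i)))) => .done i
    | .inr (.inr (.inr (.inr (.inr i)))) => .res i
  invFun
    | .arg i j => .inl ⟨i, j⟩
    | .aux i j => .inr (.inl ⟨i, j⟩)
    | .cnt i => .inr (.inr (.inl i))
    | .run i => .inr (.inr (.inr (.inl i)))
    | .done i => .inr (.inr (.inr (.inr (.inl i))))
    | .res i => .inr (.inr (.inr (.inr (.inr i))))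
  left_inv := by rintro (_ | _ | _ | _ | _ | _) <;> rfl
  right_inv := by rintro (_ | _ | _ | _ | _ | _) <;> rfl

instance : Fintype B.Reg := Fintype.ofEquiv _ B.regEquiv

variable {B} (s : B.Reg → ℝ) (i : B.Index)

/-- The simulated values of the memory gates of the `i`-th circuit. -/
def simState : (Fin (B.arity i) → ℝ) × (Fin (B.circ i).aux → ℝ) :=
  (fun j => s (.arg i j), fun j => s (.aux i j))

/-- The values of the gates of the `i`-th circuit. -/
def gateVal : (B.circ i).C.Gate → ℝ :=
  (B.circ i).C.val (simState s i).1 (simState s i).2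

/-- The values of the gates of the halting circuit of the `i`-th circuit. -/
def haltVal : (B.haltCirc i).Gate → ℝ :=
  (B.haltCirc i).val (Fin.cons (s (.cnt i)) fun j => gateVal s i ((B.circ i).haltGate j)) Fin.elim0

/-- The signal that the `i`-th circuit is running and halts in the current iteration. -/
def stopVal : ℝ := s (.run i) * haltVal s i ((B.haltCirc i).outGate 0)

/-- The value of the first output gate of the `i`-th circuit. -/
def outVal : ℝ := fstOrZero fun j => gateVal s i ((B.circ i).C.outGate j)

end Bank

/-- Formulas controlling the simulation of a bank of recurrent circuits by a recurrent circuit with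
`N` inputs and `m` outputs: when each circuit is started, with which arguments, when the simulation
is finished, and with which outputs. -/
structure Control (B : Bank) (N m : ℕ) where
  start : B.Index → Formula (Fin N ⊕ B.Reg)
  arg : ∀ i, Fin (B.arity i) → Formula (Fin N ⊕ B.Reg)
  out : Fin m → Formula (Fin N ⊕ B.Reg)
  halt : Formula (Fin N ⊕ B.Reg)

namespace Control

open Bank

variable {B : Bank} {N m : ℕ} (K : Control B N m)

/-- The new values of the registers after one iteration. -/
def next (x : Fin N → ℝ) (s : B.Reg → ℝ) : B.Reg → ℝ
  | .arg i j =>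
      mux (s (.run i)) (gateVal s i ((B.circ i).recIn j)) ((K.arg i j).eval (Sum.elim x s))
  | .aux i j => mux (s (.run i)) (gateVal s i ((B.circ i).recAux j)) ((B.circ i).init j)
  | .cnt i => s (.run i) * s (.cnt i) + 1
  | .run i => (K.start i).eval (Sum.elim x s)
  | .done i => mux (s (.done i)) 1 (stopVal s i)
  | .res i => mux (s (.done i)) (s (.res i)) (outVal s i)

/-- The values of the registers at the beginning of iteration `t + 1`. -/
def mem (x : Fin N → ℝ) (t : ℕ) : B.Reg → ℝ := (K.next x)^[t] 0

theorem mem_succ (x : Fin N → ℝ) (t : ℕ) : K.mem x (t + 1) = K.next x (K.mem x t) :=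
  Function.iterate_succ_apply' _ _ _

/-- The value of a formula in iteration `t + 1`. -/
def ev (x : Fin N → ℝ) (t : ℕ) (F : Formula (Fin N ⊕ B.Reg)) : ℝ :=
  F.eval (Sum.elim x (K.mem x t))

/-- The values of the arguments of the `i`-th circuit in iteration `t + 1`. -/
def argVal (x : Fin N → ℝ) (t : ℕ) (i : B.Index) : Fin (B.arity i) → ℝ :=
  fun j => K.ev x t (K.arg i j)

section Behaviour

variable {x : Fin N → ℝ} {i : B.Index} {t T : ℕ}

theorem mem_done_eq_zero (h : ∀ t' < t, stopVal (K.mem x t') i = 0) :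
    K.mem x t (.done i) = 0 := by
  induction t with
  | zero => rfl
  | succ t ih =>
    rw [mem_succ, next, ih fun t' ht' => h t' (ht'.trans t.lt_succ_self), mux_zero]
    exact h t t.lt_succ_self

theorem firesAt_mem_done (h0 : ∀ t' < t, stopVal (K.mem x t') i = 0)
    (h1 : stopVal (K.mem x t) i = 1) :
    FiresAt (fun t => K.mem x t (.done i)) (t + 1) ∧
      ∀ t', t + 1 ≤ t' → K.mem x t' (.res i) = outVal (K.mem x t) i := by
  have hdone (t') (ht' : t' ≤ t) : K.mem x t' (.done i) = 0 :=
    K.mem_done_eq_zero fun t'' ht'' => h0 t'' (ht''.trans_le ht')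
  have hafter (t') (ht' : t + 1 ≤ t') :
      K.mem x t' (.done i) = 1 ∧ K.mem x t' (.res i) = outVal (K.mem x t) i := by
    induction t', ht' using Nat.le_induction with
    | base => simp only [mem_succ, next, hdone t le_rfl, mux_zero, h1, and_self]
    | succ t' _ ih => simp only [mem_succ, next, ih, mux_one, and_self]
  refine ⟨fun t' => ?_, fun t' ht' => (hafter t' ht').2⟩
  split_ifs with ht'
  · exact (hafter t' ht').1
  · exact hdone t' (by omega)

theorem stopVal_eq_zero (h : ∀ t' < t, K.ev x t' (K.start i) = 0) :
    stopVal (K.mem x t) i = 0 := by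
  have hrun : K.mem x t (.run i) = 0 := by
    cases t with
    | zero => rfl
    | succ t => exact (congrFun (K.mem_succ x t) _).trans (h t t.lt_succ_self)
  rw [stopVal, hrun, zero_mul]

end Behaviour

section Started

variable {x : Fin N → ℝ} {i : B.Index} {T : ℕ}
  (hT : FiresAt (fun t => K.ev x t (K.start i)) T)

include hT

theorem mem_run_eq_zero_of_firesAt : K.mem x T (.run i) = 0 := by
  cases T with
  | zero => rfl
  | succ T => exact (congrFun (K.mem_succ x T) _).trans (hT.eq_zero T.lt_succ_self)

theorem mem_run_eq_one_of_firesAt (k : ℕ) : K.mem x (T + k + 1) (.run i) = 1 :=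
  (congrFun (K.mem_succ x _) _).trans (hT.eq_one (Nat.le_add_right T k))

theorem mem_cnt_of_firesAt (k : ℕ) : K.mem x (T + k + 1) (.cnt i) = (k + 1 : ℕ) := by
  induction k with
  | zero =>
    rw [mem_succ, next, Nat.add_zero, K.mem_run_eq_zero_of_firesAt hT, zero_mul, zero_add,
      Nat.cast_one]
  | succ k ih =>
    rw [mem_succ, next, ← Nat.add_assoc, K.mem_run_eq_one_of_firesAt hT, ih]
    push_cast
    ring

theorem simState_of_firesAt (k : ℕ) :
    simState (K.mem x (T + k + 1)) i = (B.circ i).state (K.argVal x T i) k := by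
  induction k with
  | zero =>
    simp only [mem_succ, simState, next, Nat.add_zero, K.mem_run_eq_zero_of_firesAt hT, mux_zero]
    rfl
  | succ k ih =>
    rw [RecCircuit.state_succ, ← ih, ← Nat.add_assoc, mem_succ _ _ (T + k + 1)]
    simp only [simState, next, K.mem_run_eq_one_of_firesAt hT, mux_one]
    rfl

theorem stopVal_of_firesAt (k : ℕ) : stopVal (K.mem x (T + k + 1)) i =
    if (B.circ i).haltsAt (K.argVal x T i) k then 1 else 0 := by
  rw [stopVal, K.mem_run_eq_one_of_firesAt hT, one_mul, haltVal, K.mem_cnt_of_firesAt hT]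
  unfold gateVal
  rw [K.simState_of_firesAt hT]
  exact B.eval_haltCirc i (k + 1) _ (Nat.le_add_left 1 k)

theorem stopVal_eq_zero_of_firesAt {t k : ℕ}
    (h : ∀ k' < k, (B.circ i).haltsAt (K.argVal x T i) k' = false) (ht : t < T + k + 1) :
    stopVal (K.mem x t) i = 0 := by
  rcases le_or_gt t T with htT | htT
  · exact K.stopVal_eq_zero fun t' ht' => hT.eq_zero (ht'.trans_le htT)
  · obtain ⟨k', rfl⟩ : ∃ k', t = T + k' + 1 := ⟨t - T - 1, by omega⟩
    rw [K.stopVal_of_firesAt hT, h k' (by omega)]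
    rfl

theorem mem_done_eq_zero_of_not_dom (h : ¬ ((B.circ i).eval (K.argVal x T i)).Dom) (t : ℕ) :
    K.mem x t (.done i) = 0 := by
  simp only [RecCircuit.dom_eval_iff, not_exists, Bool.not_eq_true] at h
  exact K.mem_done_eq_zero fun t' _ =>
    K.stopVal_eq_zero_of_firesAt hT (k := t') (fun k' _ => h k') (by omega)

theorem exists_firesAt_mem_done {y : Fin (B.circ i).out → ℝ}
    (hy : y ∈ (B.circ i).eval (K.argVal x T i)) :
    ∃ T', FiresAt (fun t => K.mem x t (.done i)) T' ∧
      ∀ t, T' ≤ t → K.mem x t (.res i) = fstOrZero y := by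
  obtain ⟨k, hk, hlt, rfl⟩ := (B.circ i).mem_eval_iff.1 hy
  have hout : outVal (K.mem x (T + k + 1)) i = fstOrZero ((B.circ i).C.eval
      ((B.circ i).state (K.argVal x T i) k).1 ((B.circ i).state (K.argVal x T i) k).2) := by
    rw [← K.simState_of_firesAt hT]
    rfl
  rw [← hout]
  refine ⟨_, K.firesAt_mem_done (fun t => K.stopVal_eq_zero_of_firesAt hT hlt) ?_⟩
  rw [K.stopVal_of_firesAt hT, hk]
  rfl

end Started

/-- The wires of the simulating circuit: the gates of the simulated circuits and of their halting
circuits, the new values of the registers, the outputs, and the halting signal. -/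
inductive Wire (B : Bank) (m : ℕ) : Type
  | gate (i : B.Index) (g : (B.circ i).C.Gate)
  | haltGate (i : B.Index) (g : (B.haltCirc i).Gate)
  | reg (r : B.Reg)
  | out (j : Fin m)
  | halt

/-- The wires as a sum of finite types. -/
def wireEquiv (B : Bank) (m : ℕ) : (Σ i, (B.circ i).C.Gate) ⊕ (Σ i, (B.haltCirc i).Gate) ⊕
    B.Reg ⊕ Fin m ⊕ Unit ≃ Wire B m where
  toFun
    | .inl ⟨i, g⟩ => .gate i g
    | .inr (.inl ⟨i, g⟩) => .haltGate i g
    | .inr (.inr (.inl r)) => .reg r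
    | .inr (.inr (.inr (.inl j))) => .out j
    | .inr (.inr (.inr (.inr _))) => .halt
  invFun
    | .gate i g => .inl ⟨i, g⟩
    | .haltGate i g => .inr (.inl ⟨i, g⟩)
    | .reg r => .inr (.inr (.inl r))
    | .out j => .inr (.inr (.inr (.inl j)))
    | .halt => .inr (.inr (.inr (.inr ())))
  left_inv := by rintro (_ | _ | _ | _ | _) <;> rfl
  right_inv := by rintro (_ | _ | _ | _ | _) <;> rfl

instance : Fintype (Wire B m) := Fintype.ofEquiv _ (wireEquiv B m)

/-- The variables of the formulas of the simulating circuit. -/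
abbrev Var (B : Bank) (N m : ℕ) : Type := Fin N ⊕ Fin (Fintype.card B.Reg) ⊕ Wire B m

/-- The memory gate holding an input or a register, as a variable. -/
def memVar : Fin N ⊕ B.Reg → Var B N m
  | .inl j => .inl j
  | .inr r => .inr (.inl (Fintype.equivFin B.Reg r))

/-- The formula for the old value of a register. -/
def reg (r : B.Reg) : Formula (Var B N m) := .var (memVar (.inr r))

/-- The formula for the value of a wire. -/
def wire (g : Wire B m) : Formula (Var B N m) := .var (.inr (.inr g))

/-- The formula for the first output of a simulated circuit. -/
def fstOut (i : B.Index) : Formula (Var B N m) :=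
  if h : 0 < (B.circ i).out then wire (.gate i ((B.circ i).C.outGate ⟨0, h⟩)) else .const 0

/-- The formulas of the simulating circuit. -/
def form : Wire B m → Formula (Var B N m)
  | .gate i g => ((B.circ i).C.label g).toFormula (fun j => reg (.arg i j))
      (fun j => reg (.aux i j)) fun g => .inr (.inr (.gate i g))
  | .haltGate i g => ((B.haltCirc i).label g).toFormula
      (Fin.cons (reg (.cnt i)) fun j => wire (.gate i ((B.circ i).haltGate j)))
      Fin.elim0 fun g => .inr (.inr (.haltGate i g))
  | .reg (.arg i j) => .mux (reg (.run i)) (wire (.gate i ((B.circ i).recIn j)))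
      ((K.arg i j).rename memVar)
  | .reg (.aux i j) => .mux (reg (.run i)) (wire (.gate i ((B.circ i).recAux j)))
      (.const ((B.circ i).init j))
  | .reg (.cnt i) => reg (.run i) * reg (.cnt i) + .const 1
  | .reg (.run i) => (K.start i).rename memVar
  | .reg (.done i) => .mux (reg (.done i)) (.const 1)
      (reg (.run i) * wire (.haltGate i ((B.haltCirc i).outGate 0)))
  | .reg (.res i) => .mux (reg (.done i)) (reg (.res i)) (fstOut i)
  | .out j => (K.out j).rename memVar
  | .halt => K.halt.rename memVar

/-- The levels of the wires, where `D` is a bound for the depths of the simulated circuits and of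
their halting circuits. -/
def lev (D : ℕ) : Wire B m → ℕ
  | .gate i g => (B.circ i).C.level g
  | .haltGate i g => D + 1 + (B.haltCirc i).level g
  | _ => 2 * D + 2

/-- The system of formulas of the simulating circuit. -/
abbrev netlist (D : ℕ) : Netlist N (Fintype.card B.Reg) m where
  Wire := Wire B m
  fintypeWire := inferInstance
  form := K.form
  lev := lev D
  out := .out

/-- The values of the wires. -/
def wireVal (x : Fin N → ℝ) (s : B.Reg → ℝ) : Wire B m → ℝ
  | .gate i g => gateVal s i g
  | .haltGate i g => haltVal s i g
  | .reg r => K.next x s r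
  | .out j => (K.out j).eval (Sum.elim x s)
  | .halt => K.halt.eval (Sum.elim x s)

/-- The values of the variables of the formulas of the simulating circuit. -/
def varVal (x : Fin N → ℝ) (s : B.Reg → ℝ) : Var B N m → ℝ :=
  Sum.elim x (Sum.elim (s ∘ (Fintype.equivFin B.Reg).symm) (K.wireVal x s))

section VarVal

variable (x : Fin N → ℝ) (s : B.Reg → ℝ)

theorem varVal_comp_memVar : K.varVal x s ∘ memVar = Sum.elim x s := by
  funext v
  rcases v with j | r
  · rfl
  · exact congrArg s ((Fintype.equivFin B.Reg).symm_apply_apply r)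

theorem eval_reg (r : B.Reg) : (reg r).eval (K.varVal x s) = s r :=
  congrFun (K.varVal_comp_memVar x s) (.inr r)

theorem eval_wire (g : Wire B m) : (wire g).eval (K.varVal x s) = K.wireVal x s g := rfl

theorem eval_fstOut (i : B.Index) : (fstOut i).eval (K.varVal x s) = outVal s i := by
  rw [fstOut, outVal, fstOrZero]
  split_ifs <;> rfl

theorem wireVal_eq (g : Wire B m) : K.wireVal x s g = (K.form g).eval (K.varVal x s) := by
  rcases g with ⟨i, g⟩ | ⟨i, g⟩ | r | j | -
  · simp only [form, GateLabel.eval_toFormula, eval_reg]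
    exact (B.circ i).C.val_eq _ _ g
  · have hcons (j) : ((Fin.cons (reg (.cnt i)) fun j => wire (.gate i ((B.circ i).haltGate j)) :
        Fin ((B.circ i).numHalt + 1) → Formula (Var B N m)) j).eval (K.varVal x s) =
        (Fin.cons (s (.cnt i)) fun j => gateVal s i ((B.circ i).haltGate j) :
          Fin ((B.circ i).numHalt + 1) → ℝ) j := by
      cases j using Fin.cases with
      | zero => exact K.eval_reg x s _
      | succ j => rfl
    simp only [form, GateLabel.eval_toFormula, hcons]
    rw [Subsingleton.elim (fun j => Formula.eval _ _) Fin.elim0]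
    exact (B.haltCirc i).val_eq _ _ g
  · cases r <;> simp only [form, wireVal, next, stopVal, Formula.eval_mux, Formula.eval_add,
      Formula.eval_mul, Formula.eval_const, Formula.eval_rename, varVal_comp_memVar, eval_reg,
      eval_wire, eval_fstOut]
  · rw [form, Formula.eval_rename, varVal_comp_memVar, wireVal]
  · rw [form, Formula.eval_rename, varVal_comp_memVar, wireVal]

end VarVal

end Control

/-- The circuits of the bank and their halting circuits use only functions in `A`, and have size at
most `W` and depth at most `D`. -/
structure Bank.Bounded (B : Bank) (A : Set (ℝ → ℝ)) (W D : ℕ) : Prop where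
  usesOnly : ∀ i, (B.circ i).C.UsesOnly A
  usesOnly_halt : ∀ i, (B.haltCirc i).UsesOnly A
  size_le : ∀ i, (B.circ i).C.size ≤ W
  size_halt_le : ∀ i, (B.haltCirc i).size ≤ W
  depth_le : ∀ i, (B.circ i).C.depth ≤ D
  depth_halt_le : ∀ i, (B.haltCirc i).depth ≤ D

namespace Control

open Bank

variable {B : Bank} {N m : ℕ} {K : Control B N m} {A : Set (ℝ → ℝ)} {W c D : ℕ}

/-- The formulas of the control use only functions in `A`, have fan-in at most `W + 2` and height at
most `c`. -/
structure Bounded (K : Control B N m) (A : Set (ℝ → ℝ)) (W c : ℕ) : Prop where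
  start : ∀ i, (K.start i).Bounded A W (fun _ => True) c
  arg : ∀ i j, (K.arg i j).Bounded A W (fun _ => True) c
  out : ∀ j, (K.out j).Bounded A W (fun _ => True) c
  halt : K.halt.Bounded A W (fun _ => True) c

theorem lev_gate_le (hB : B.Bounded A W D) (i : B.Index) (g : (B.circ i).C.Gate) :
    lev D (.gate i g : Wire B m) ≤ D :=
  ((B.circ i).C.level_le_depth g).trans (hB.depth_le i)

theorem lev_haltGate_le (hB : B.Bounded A W D) (i : B.Index) (g : (B.haltCirc i).Gate) :
    lev D (.haltGate i g : Wire B m) ≤ 2 * D + 1 := by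
  have h := ((B.haltCirc i).level_le_depth g).trans (hB.depth_halt_le i)
  rw [lev]
  omega

theorem bounded_reg (r : B.Reg) (g : Wire B m) :
    (reg r).Bounded A W ((K.netlist D).Lower g) c := .var trivial

theorem bounded_wire {g g' : Wire B m} (h : lev D g < lev D g') :
    (wire g).Bounded A W ((K.netlist D).Lower g') c := .var h

theorem bounded_rename_memVar {F : Formula (Fin N ⊕ B.Reg)} {c' : ℕ}
    (hF : F.Bounded A W (fun _ => True) c) (hc : c ≤ c') (g : Wire B m) :
    (F.rename memVar).Bounded A W ((K.netlist D).Lower g) c' :=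
  (hF.rename (by rintro (_ | _) - <;> trivial)).of_le hc

theorem bounded_form_gate (hB : B.Bounded A W D) (i : B.Index) (g : (B.circ i).C.Gate) :
    (K.form (.gate i g)).Bounded A W ((K.netlist D).Lower (.gate i g)) 1 := by
  refine GateLabel.bounded_toFormula (P := (K.netlist D).Lower (.gate i g))
    (e := fun g => .inr (.inr (.gate i g))) (fun j => ?_) (fun j => ?_)
    ((Finset.card_le_univ _).trans ((hB.size_le i).trans (Nat.le_add_right W 2)))
    (fun _ hh => (B.circ i).C.level_lt hh) (hB.usesOnly i g)
  exacts [bounded_reg _ _, bounded_reg _ _]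

theorem bounded_form_haltGate (hB : B.Bounded A W D) (i : B.Index) (g : (B.haltCirc i).Gate) :
    (K.form (.haltGate i g)).Bounded A W ((K.netlist D).Lower (.haltGate i g)) 1 := by
  refine GateLabel.bounded_toFormula (P := (K.netlist D).Lower (.haltGate i g))
    (e := fun g => .inr (.inr (.haltGate i g))) (fun j => ?_) (fun j => j.elim0)
    ((Finset.card_le_univ _).trans ((hB.size_halt_le i).trans (Nat.le_add_right W 2)))
    (fun _ hh => Nat.add_lt_add_left ((B.haltCirc i).level_lt hh) (D + 1))
    (hB.usesOnly_halt i g)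
  cases j using Fin.cases with
  | zero => exact bounded_reg _ _
  | succ j =>
    exact bounded_wire ((Nat.lt_succ_of_le (lev_gate_le hB i _)).trans_le (Nat.le_add_right _ _))

theorem Bounded.form_reg (hB : B.Bounded A W D) (hK : K.Bounded A W c) (r : B.Reg) :
    (K.form (.reg r)).Bounded A W ((K.netlist D).Lower (.reg r)) (c + 5) := by
  have hgate (i : B.Index) (g : (B.circ i).C.Gate) :
      (wire (.gate i g)).Bounded A W ((K.netlist D).Lower (.reg r)) (c + 3) :=
    bounded_wire ((lev_gate_le hB i g).trans_lt (show D < 2 * D + 2 by omega))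
  have hhalt (i : B.Index) (g : (B.haltCirc i).Gate) :
      (wire (.haltGate i g)).Bounded A W ((K.netlist D).Lower (.reg r)) (c + 2) :=
    bounded_wire (Nat.lt_succ_of_le (lev_haltGate_le hB i g))
  have hreg (r' : B.Reg) (c : ℕ) : (reg r').Bounded A W ((K.netlist D).Lower (.reg r)) c :=
    bounded_reg _ _
  cases r with
  | arg i j => exact .mux (hreg _ _) (hgate _ _) (bounded_rename_memVar (hK.arg i j) (by omega) _)
  | aux i j => exact .mux (hreg _ _) (hgate _ _) (.const _)
  | cnt i => exact .add (.mul (hreg _ _) (hreg _ _)) (.const 1)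
  | run i => exact bounded_rename_memVar (hK.start i) (by omega) _
  | done i => exact .mux (hreg _ _) (.const 1) (.mul (hreg _ _) (hhalt _ _))
  | res i =>
    refine .mux (hreg _ _) (hreg _ _) ?_
    rw [fstOut]
    split_ifs
    · exact hgate _ _
    · exact .const 0

theorem Bounded.netlist (hB : B.Bounded A W D) (hK : K.Bounded A W c) :
    (K.netlist D).Bounded A W (c + 5) (2 * D + 2) where
  form
    | .gate i g => (bounded_form_gate hB i g).of_le (Nat.le_add_left 1 (c + 4))
    | .haltGate i g => (bounded_form_haltGate hB i g).of_le (Nat.le_add_left 1 (c + 4))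
    | .reg r => hK.form_reg hB r
    | .out j => bounded_rename_memVar (hK.out j) (Nat.le_add_right c 5) _
    | .halt => bounded_rename_memVar hK.halt (Nat.le_add_right c 5) _
  lev_le
    | .gate i g => (lev_gate_le (m := m) hB i g).trans (by omega)
    | .haltGate i g => (lev_haltGate_le (m := m) hB i g).trans (Nat.le_succ _)
    | .reg _ | .out _ | .halt => le_rfl

/-- The recurrent circuit simulating a bank of recurrent circuits under a control. -/
abbrev toRec (hB : B.Bounded A W D) (hK : K.Bounded A W c) : RecCircuit N where
  aux := Fintype.card B.Reg
  out := m
  C := (hK.netlist hB).toCircuit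
  init := 0
  recIn := Netlist.Gate.input
  recAux j := (K.netlist D).wireGate (.reg ((Fintype.equivFin B.Reg).symm j))
  recIn_ne _ _ := nofun
  recAux_ne _ _ := nofun
  numHalt := 1
  haltGate := ⟨fun _ => (K.netlist D).wireGate .halt, Function.injective_of_subsingleton _⟩
  halt _ v := decide (0 < v 0)

theorem state_toRec (hB : B.Bounded A W D) (hK : K.Bounded A W c) (x : Fin N → ℝ) (t : ℕ) :
    (toRec hB hK).state x t = (x, K.mem x t ∘ (Fintype.equivFin B.Reg).symm) := by
  induction t with
  | zero => rfl
  | succ t ih =>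
    rw [RecCircuit.state_succ, ih, mem_succ]
    refine Prod.ext (funext fun j => ?_) (funext fun j => ?_)
    · exact (hK.netlist hB).val_toCircuit_input _ _ j
    · exact (hK.netlist hB).val_toCircuit (K.wireVal_eq x (K.mem x t)) _

theorem haltsAt_toRec (hB : B.Bounded A W D) (hK : K.Bounded A W c) (x : Fin N → ℝ) (t : ℕ) :
    (toRec hB hK).haltsAt x t = decide (0 < K.ev x t K.halt) := by
  rw [RecCircuit.haltsAt, state_toRec]
  exact congrArg (fun r : ℝ => decide (0 < r))
    ((hK.netlist hB).val_toCircuit (K.wireVal_eq x (K.mem x t)) .halt)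

theorem eval_toRec_of_firesAt (hB : B.Bounded A W D) (hK : K.Bounded A W c) {x : Fin N → ℝ} {T : ℕ}
    (hT : FiresAt (fun t => K.ev x t K.halt) T) :
    (toRec hB hK).eval x = Part.some fun j => K.ev x T (K.out j) := by
  refine Part.eq_some_iff.2 ((RecCircuit.mem_eval_iff _).2 ⟨T, ?_, fun t ht => ?_, ?_⟩)
  · simp only [haltsAt_toRec, hT.eq_one le_rfl, zero_lt_one, decide_true]
  · simp only [haltsAt_toRec, hT.eq_zero ht, lt_irrefl, decide_false]
  · rw [state_toRec]
    exact funext fun j => (hK.netlist hB).eval_toCircuit (K.wireVal_eq x (K.mem x T)) j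

theorem eval_toRec_of_forall (hB : B.Bounded A W D) (hK : K.Bounded A W c) {x : Fin N → ℝ}
    (h : ∀ t, K.ev x t K.halt = 0) : (toRec hB hK).eval x = Part.none := by
  simp only [Part.eq_none_iff', RecCircuit.dom_eval_iff, haltsAt_toRec, h, lt_irrefl, decide_false,
    Bool.false_eq_true, exists_false, not_false_eq_true]

theorem usesOnly_toRec (hB : B.Bounded A W D) (hK : K.Bounded A W c) :
    (toRec hB hK).C.UsesOnly A := (hK.netlist hB).usesOnly_toCircuit

theorem depth_toRec_le (hB : B.Bounded A W D) (hK : K.Bounded A W c) :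
    (toRec hB hK).C.depth ≤ (2 * D + 3) * (2 * (c + 5) + 2) + 1 :=
  (hK.netlist hB).depth_toCircuit_le

theorem card_reg_le (hB : B.Bounded A W D) (harity : ∀ i, B.arity i ≤ W) :
    Fintype.card B.Reg ≤ Fintype.card B.Index * (2 * W + 4) := by
  have harg : ∑ i, B.arity i ≤ Fintype.card B.Index * W :=
    Finset.sum_le_card_nsmul _ _ _ fun i _ => harity i
  have haux : ∑ i, (B.circ i).aux ≤ Fintype.card B.Index * W :=
    Finset.sum_le_card_nsmul _ _ _ fun i _ => (B.circ i).C.aux_le_size.trans (hB.size_le i)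
  rw [Fintype.card_congr B.regEquiv.symm]
  simp only [Fintype.card_sum, Fintype.card_sigma, Fintype.card_fin]
  linarith

theorem card_wire_le (hB : B.Bounded A W D) (harity : ∀ i, B.arity i ≤ W) :
    Fintype.card (Wire B m) ≤ Fintype.card B.Index * (4 * W + 4) + m + 1 := by
  have hgate : ∑ i, Fintype.card (B.circ i).C.Gate ≤ Fintype.card B.Index * W :=
    Finset.sum_le_card_nsmul _ _ _ fun i _ => hB.size_le i
  have hhalt : ∑ i, Fintype.card (B.haltCirc i).Gate ≤ Fintype.card B.Index * W :=
    Finset.sum_le_card_nsmul _ _ _ fun i _ => hB.size_halt_le i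
  rw [Fintype.card_congr (wireEquiv B m).symm]
  simp only [Fintype.card_sum, Fintype.card_sigma, Fintype.card_fin, Fintype.card_unit]
  linarith [card_reg_le hB harity]

theorem size_toRec_le (hB : B.Bounded A W D) (hK : K.Bounded A W c)
    (harity : ∀ i, B.arity i ≤ W) :
    (toRec hB hK).C.size ≤ N + Fintype.card B.Index * (2 * W + 4) + m +
      (Fintype.card B.Index * (4 * W + 4) + m + 1) * (2 * (W + 3) ^ (c + 5)) := by
  refine (hK.netlist hB).size_toCircuit_le.trans ?_
  gcongr
  · exact card_reg_le hB harity
  · exact card_wire_le hB harity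

end Control

/-! ### Networks on directed graphs -/

section RelNbrs

variable {n : ℕ} (r : Fin n → Fin n → Prop) (v : Fin n)

open Classical in
/-- The successors of `v` with respect to a relation, in order. -/
def relNbrs : List (Fin n) := (List.finRange n).filter fun w => r v w

/-- The number of successors of `v`, as one of the possible values `0, …, n`. -/
def relDeg : Fin (n + 1) :=
  ⟨(relNbrs r v).length,
    Nat.lt_succ_of_le ((List.length_filter_le _ _).trans_eq List.length_finRange)⟩

open Classical in
theorem sum_relNbrs (F : Fin n → ℝ) :
    ∑ w, (if r v w then F w else 0) = ∑ i, F ((relNbrs r v).get i) := by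
  have hset : Finset.univ.filter (r v) = (relNbrs r v).toFinset := by
    ext w
    simp only [relNbrs, Finset.mem_filter_univ, List.mem_toFinset, List.mem_filter,
      List.mem_finRange, decide_eq_true_eq, true_and]
  rw [← Finset.sum_filter, hset]
  exact (List.sum_toFinset F ((List.nodup_finRange n).filter _)).trans
    (Fin.sum_univ_fun_getElem _ F).symm

theorem strictMono_get_relNbrs : StrictMono (relNbrs r v).get :=
  fun i j hij => List.pairwise_iff_get.1 ((List.pairwise_lt_finRange n).filter _) i j hij

open Classical in
theorem sum_lt_get_relNbrs (i : Fin (relNbrs r v).length) :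
    ∑ w, (if r v w then if w < (relNbrs r v).get i then (1 : ℝ) else 0 else 0) = (i : ℕ) := by
  rw [sum_relNbrs r v fun w => if w < (relNbrs r v).get i then (1 : ℝ) else 0]
  simp only [(strictMono_get_relNbrs r v).lt_iff_lt, Finset.sum_boole, Finset.filter_gt_eq_Iio,
    Fin.card_Iio]

end RelNbrs

namespace RecCGNN

variable (M : RecCGNN) {n : ℕ} {r : Fin n → Fin n → Prop} {h₀ : Fin n → ℝ}

/-- One layer of the network on a directed graph. -/
def relStep (r : Fin n → Fin n → Prop) (i : ℕ) (h : Fin n → ℝ) : Part (Fin n → ℝ) where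
  Dom := ∀ v, (M.layer i (h v :: (relNbrs r v).map h)).Dom
  get := fun hd v => M.act i ((M.layer i (h v :: (relNbrs r v).map h)).get (hd v))

/-- The feature values of a directed graph after `i` layers. -/
def relFeats (r : Fin n → Fin n → Prop) (h₀ : Fin n → ℝ) : ℕ → Part (Fin n → ℝ)
  | 0 => Part.some h₀
  | i + 1 => (relFeats r h₀ i).bind (M.relStep r (i + 1))

theorem feats_eq (G : LGraph) (i : ℕ) : M.feats G i = M.relFeats G.graph.Adj G.feat i := by
  induction i with
  | zero => rfl
  | succ i ih => exact congrArg (fun p => Part.bind p (M.layerStep G (i + 1))) ih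

theorem relFeats_dom (h : ∀ i g, (M.relStep r i g).Dom) (i : ℕ) : (M.relFeats r h₀ i).Dom := by
  induction i with
  | zero => trivial
  | succ i ih => exact ⟨ih, h _ _⟩

theorem relFeats_dom_of_le {i j : ℕ} (hij : i ≤ j) (h : (M.relFeats r h₀ j).Dom) :
    (M.relFeats r h₀ i).Dom := by
  induction hij with
  | refl => exact h
  | step _ ih => exact ih h.1

theorem eval_eq {d : ℕ} (hd : 1 ≤ d) (hM : ∀ i l, M.halt i l = decide (i = d)) (G : LGraph) :
    M.eval G = (M.relFeats G.graph.Adj G.feat d).map fun h => { G with feat := h } := by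
  obtain ⟨e, rfl⟩ := Nat.exists_eq_add_of_le' hd
  have hhalt (k : ℕ) {h : Fin G.card → ℝ} (hh : h ∈ M.feats G (k + 1)) :
      decide (k = e) ∈ (M.feats G (k + 1)).map fun h => M.halt (k + 1) (List.ofFn h) := by
    simpa only [hM, Nat.add_right_cancel_iff] using
      Part.mem_map (fun h => M.halt (k + 1) (List.ofFn h)) hh
  rw [← feats_eq]
  refine Part.ext fun H => Part.mem_bind_iff.trans ⟨?_, fun hH => ?_⟩
  · rintro ⟨k, hk, hH⟩
    obtain ⟨h, -, hk⟩ := (Part.mem_map_iff _).1 (Nat.mem_rfind.1 hk).1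
    obtain rfl : k = e := by simpa only [hM, Nat.add_right_cancel_iff, decide_eq_true_eq] using hk
    exact hH
  · obtain ⟨h, hh, -⟩ := (Part.mem_map_iff _).1 hH
    have hdom (k : ℕ) (hk : k < e) : (M.feats G (k + 1)).Dom := by
      rw [feats_eq] at hh ⊢
      exact M.relFeats_dom_of_le (Nat.succ_le_succ hk.le) (Part.dom_iff_mem.2 ⟨h, hh⟩)
    refine ⟨e, Nat.mem_rfind.2 ⟨?_, fun {k} hk => ?_⟩, hH⟩
    · simpa only [decide_true] using hhalt e hh
    · simpa only [hk.ne, decide_false] using hhalt k (Part.get_mem (hdom k hk))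

end RecCGNN

/-! ### The circuit simulating a network -/

theorem RecFamily.eval_ofFn (R : RecFamily) {n : ℕ} (z : Fin n → ℝ) :
    R.eval (List.ofFn z) = ((R n).eval z).map List.ofFn := by
  have hcast {n' : ℕ} (h : n' = n) (z' : Fin n' → ℝ) (hz : ∀ i, z' i = z (Fin.cast h i)) :
      ((R n').eval z').map List.ofFn = ((R n).eval z).map List.ofFn := by
    subst h
    rw [show z' = z from funext hz]
  exact hcast List.length_ofFn _ fun i => List.get_ofFn z i

namespace Formula

variable {V : Type} {ρ : V → ℝ} {F : Formula V}

/-- A formula testing whether an integral value is `j`. -/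
def isEq (F : Formula V) (j : ℕ) : Formula V :=
  func sgn (F - const (j - 1 / 2)) * func sgn (const (j + 1 / 2) - F)

theorem eval_isEq {a : ℕ} (h : F.eval ρ = a) (j : ℕ) :
    (isEq F j).eval ρ = if a = j then 1 else 0 := by
  simp only [isEq, eval_mul, eval_func, eval_sub, eval_const, h, sgn, sub_pos]
  rcases lt_trichotomy a j with h | rfl | h
  · have : (a : ℝ) + 1 ≤ j := by exact_mod_cast h
    rw [if_neg (by linarith : ¬ (j : ℝ) - 1 / 2 < a), if_neg h.ne, zero_mul]
  · rw [if_pos (by linarith), if_pos (by linarith), if_pos rfl, one_mul]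
  · have : (j : ℝ) + 1 ≤ a := by exact_mod_cast h
    rw [if_neg (by linarith : ¬ (a : ℝ) < j + 1 / 2), if_neg h.ne', mul_zero]

/-- A formula for the value of `G j`, where `j < m` is the integral value of `F`. -/
def select {m : ℕ} (F : Formula V) (G : Fin m → Formula V) : Formula V :=
  sum fun j : Fin m => isEq F j * G j

theorem eval_select {m : ℕ} {j : Fin m} (h : F.eval ρ = (j : ℕ)) (G : Fin m → Formula V) :
    (select F G).eval ρ = (G j).eval ρ := by
  simp only [select, eval_sum, eval_mul, eval_isEq h, Fin.val_inj, ite_mul, one_mul, zero_mul,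
    Finset.sum_ite_eq, Finset.mem_univ, if_true]

theorem Bounded.isEq {A : Set (ℝ → ℝ)} {W c : ℕ} {P : V → Prop} (hA : sgn ∈ A)
    (hF : F.Bounded A W P (c + 1)) (j : ℕ) : (isEq F j).Bounded A W P (c + 5) :=
  .mul (.func hA (hF.sub (.const _))) (.func hA (.sub (.const _) hF))

theorem Bounded.select {A : Set (ℝ → ℝ)} {W c m : ℕ} {P : V → Prop} {G : Fin m → Formula V}
    (hA : sgn ∈ A) (hm : m ≤ W + 2) (hF : F.Bounded A W P (c + 1))
    (hG : ∀ j, (G j).Bounded A W P (c + 5)) : (select F G).Bounded A W P (c + 7) :=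
  .sum ((Fintype.card_fin m).trans_le hm) fun j => (hF.isEq hA j).mul (hG j)

end Formula

/-- Recurrent circuit families with their halting circuits, and activation functions, for the `d`
layers of a network. -/
structure Layers (d : ℕ) where
  R : Fin d → RecFamily
  H : Fin d → ∀ k, ExtCircuit k 0 1
  H_eval : ∀ (k : Fin d) (n i : ℕ) (v : Fin (R k n).numHalt → ℝ), 1 ≤ i →
    (H k ((R k n).numHalt + 1)).eval (Fin.cons (i : ℝ) v) Fin.elim0 0 =
      if (R k n).halt i v then 1 else 0
  act : Fin d → ℝ → ℝ

namespace Layers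

variable {d : ℕ} (L : Layers d) (n : ℕ)

/-- For each layer and each vertex, the members of the layer's circuit family for all possible
degrees of the vertex. -/
abbrev bank : Bank where
  Index := Fin d × Fin n × Fin (n + 1)
  fintypeIndex := inferInstance
  arity i := i.2.2 + 1
  circ i := L.R i.1 (i.2.2 + 1)
  haltCirc i := L.H i.1 _
  eval_haltCirc i := L.H_eval i.1 _

variable {n} {N : ℕ} (hN : n * n + n ≤ N)

/-- The position of an entry of the adjacency matrix in the encoding of a graph. -/
def adjIdx (v w : Fin n) : Fin N :=
  Fin.castLE hN (Fin.castAdd n (finProdFinEquiv (v, w)))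

/-- The position of a feature value in the encoding of a graph. -/
def featIdx (v : Fin n) : Fin N := Fin.castLE hN (Fin.natAdd (n * n) v)

/-- The directed graph read off a tuple of real numbers. -/
def adjRel (x : Fin N → ℝ) (v w : Fin n) : Prop := 0 < x (adjIdx hN v w)

/-- The formula for an edge. -/
def edge (v w : Fin n) : Formula (Fin N ⊕ (L.bank n).Reg) :=
  .func sgn (.var (.inl (adjIdx hN v w)))

/-- The formula for the degree of a vertex. -/
def degree (v : Fin n) : Formula (Fin N ⊕ (L.bank n).Reg) := .sum fun w => L.edge hN v w

/-- The formula for the number of neighbours of `v` before `w`. -/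
def rank (v w : Fin n) : Formula (Fin N ⊕ (L.bank n).Reg) :=
  .sum fun w' => if w' < w then L.edge hN v w' else .const 0

/-- The formula for the feature value of `v` after `k` layers. -/
def feat (k : Fin (d + 1)) (v : Fin n) : Formula (Fin N ⊕ (L.bank n).Reg) :=
  Fin.cases (.var (.inl (featIdx hN v)))
    (fun k => .func (L.act k) (.select (L.degree hN v) fun δ => .var (.inr (.res (k, v, δ))))) k

/-- The formula for the signal that the feature values after `k` layers are available. -/
def ready (k : Fin (d + 1)) : Formula (Fin N ⊕ (L.bank n).Reg) :=
  Fin.cases (.const 1)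
    (fun k => .prod fun v => .select (L.degree hN v) fun δ => .var (.inr (.done (k, v, δ)))) k

/-- The formula for the feature value of the `j`-th neighbour of `v` after `k` layers. -/
def nbrFeat (k : Fin (d + 1)) (v : Fin n) (j : ℕ) : Formula (Fin N ⊕ (L.bank n).Reg) :=
  .sum fun w => L.edge hN v w * (.isEq (L.rank hN v w) j * L.feat hN k w)

/-- The formulas controlling the simulation of the network. -/
def control : Control (L.bank n) N (n * n + n) where
  start i := L.ready hN i.1.castSucc
  arg i := Fin.cons (L.feat hN i.1.castSucc i.2.1) fun j => L.nbrFeat hN i.1.castSucc i.2.1 j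
  out := Fin.append (fun a => .var (.inl (Fin.castLE hN (Fin.castAdd n a))))
    fun v => L.feat hN (Fin.last d) v
  halt := L.ready hN (Fin.last d)

section Eval

variable (x : Fin N → ℝ) (s : (L.bank n).Reg → ℝ) (v : Fin n)

open Classical in
theorem eval_edge (w : Fin n) :
    (L.edge hN v w).eval (Sum.elim x s) = if adjRel hN x v w then 1 else 0 := rfl

theorem eval_degree :
    (L.degree hN v).eval (Sum.elim x s) = (relDeg (adjRel hN x) v : ℕ) := by
  simp only [degree, Formula.eval_sum, eval_edge]
  rw [sum_relNbrs _ v fun _ => 1, Finset.sum_const, Finset.card_univ, Fintype.card_fin,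
    nsmul_one, relDeg]

theorem eval_rank (i : Fin (relNbrs (adjRel hN x) v).length) :
    (L.rank hN v ((relNbrs (adjRel hN x) v).get i)).eval (Sum.elim x s) = (i : ℕ) := by
  classical
  rw [← sum_lt_get_relNbrs, rank, Formula.eval_sum]
  refine Finset.sum_congr rfl fun w _ => ?_
  by_cases hw : w < (relNbrs (adjRel hN x) v).get i
  · rw [if_pos hw, if_pos hw, eval_edge]
  · rw [if_neg hw, if_neg hw, ite_self, Formula.eval_const]

theorem eval_nbrFeat (k : Fin (d + 1)) (j : Fin (relNbrs (adjRel hN x) v).length) :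
    (L.nbrFeat hN k v j).eval (Sum.elim x s) =
      (L.feat hN k ((relNbrs (adjRel hN x) v).get j)).eval (Sum.elim x s) := by
  simp only [nbrFeat, Formula.eval_sum, Formula.eval_mul, eval_edge, ite_mul, one_mul, zero_mul]
  rw [sum_relNbrs _ v fun w => (Formula.isEq (L.rank hN v w) j).eval (Sum.elim x s) *
    (L.feat hN k w).eval (Sum.elim x s)]
  simp only [Formula.eval_isEq (L.eval_rank hN x s v _), Fin.val_inj, ite_mul, one_mul, zero_mul,
    Finset.sum_ite_eq', Finset.mem_univ, if_true]

theorem ev_ready_succ (k : Fin d) (t : ℕ) : (L.control hN).ev x t (L.ready hN k.succ) =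
    ∏ v, (L.control hN).mem x t (.done (k, v, relDeg (adjRel hN x) v)) :=
  Fintype.prod_congr _ _ fun v =>
    Formula.eval_select (L.eval_degree hN x ((L.control hN).mem x t) v)
      fun δ => .var (.inr (.done (k, v, δ)))

theorem ev_feat_succ (k : Fin d) (t : ℕ) : (L.control hN).ev x t (L.feat hN k.succ v) =
    L.act k ((L.control hN).mem x t (.res (k, v, relDeg (adjRel hN x) v))) :=
  congrArg (L.act k) (Formula.eval_select (L.eval_degree hN x _ v) _)

theorem ofFn_argVal {k : Fin d} {t : ℕ} {h : Fin n → ℝ}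
    (hfeat : ∀ v, (L.control hN).ev x t (L.feat hN k.castSucc v) = h v) :
    List.ofFn ((L.control hN).argVal x t (k, v, relDeg (adjRel hN x) v)) =
      h v :: (relNbrs (adjRel hN x) v).map h := by
  refine (List.ofFn_succ ..).trans (congrArg₂ List.cons (hfeat v) ?_)
  rw [← List.ofFn_getElem_eq_map]
  exact congrArg List.ofFn <| funext fun j =>
    (L.eval_nbrFeat hN x _ v k.castSucc j).trans (hfeat _)

end Eval

/-- The circuit families and activation functions of `L` are those of the first `d` layers of the
network `M`. -/
def Implements (M : RecCGNN) : Prop := ∀ k : Fin d,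
  (fun x => (M.layer (k + 1) x).map fun y => [y]) = (L.R k).eval ∧ L.act k = M.act (k + 1)

variable {L} {M : RecCGNN}

theorem Implements.layer_ofFn (hL : L.Implements M) (k : Fin d) {m : ℕ} (z : Fin m → ℝ) :
    M.layer (k + 1) (List.ofFn z) = ((L.R k m).eval z).map fstOrZero := by
  have h := congrArg (Part.map List.headI) (congrFun (hL k).1 (List.ofFn z))
  rw [RecFamily.eval_ofFn, Part.map_map, Part.map_map] at h
  refine Eq.trans ?_ (h.trans ?_)
  · exact (Part.map_id' (fun _ => rfl) _).symm
  · exact congrArg (fun f => Part.map f _) (funext headI_ofFn)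

section Simulation

variable (L) (x : Fin N → ℝ)

/-- At some time the simulation signals that the feature values after `k` layers are available,
and from then on they are `h`. -/
def Available (k : Fin (d + 1)) (h : Fin n → ℝ) : Prop :=
  ∃ T, FiresAt (fun t => (L.control hN).ev x t (L.ready hN k)) T ∧
    ∀ t, T ≤ t → ∀ v, (L.control hN).ev x t (L.feat hN k v) = h v

theorem available_zero : L.Available hN x 0 fun v => x (featIdx hN v) :=
  ⟨0, fun _ => rfl, fun _ _ _ => rfl⟩

variable {L hN x}

theorem Implements.layer_eq (hL : L.Implements M) {k : Fin d} {h : Fin n → ℝ} {T : ℕ}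
    (hfeat : ∀ v, (L.control hN).ev x T (L.feat hN k.castSucc v) = h v) (v : Fin n) :
    M.layer (k + 1) (h v :: (relNbrs (adjRel hN x) v).map h) =
      ((L.R k (relDeg (adjRel hN x) v + 1)).eval
        ((L.control hN).argVal x T (k, v, relDeg (adjRel hN x) v))).map fstOrZero := by
  rw [← L.ofFn_argVal hN x v hfeat]
  exact hL.layer_ofFn k _

theorem Available.succ (hL : L.Implements M) {k : Fin d} {h h' : Fin n → ℝ}
    (hk : L.Available hN x k.castSucc h) (hh' : h' ∈ M.relStep (adjRel hN x) (k + 1) h) :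
    L.Available hN x k.succ h' := by
  obtain ⟨T, hT, hfeat⟩ := hk
  obtain ⟨hdom, rfl⟩ := hh'
  have hvertex (v : Fin n) {y : ℝ}
      (hy : y ∈ M.layer (k + 1) (h v :: (relNbrs (adjRel hN x) v).map h)) : ∃ T',
      FiresAt (fun t => (L.control hN).mem x t (.done (k, v, relDeg (adjRel hN x) v))) T' ∧
        ∀ t, T' ≤ t → (L.control hN).mem x t (.res (k, v, relDeg (adjRel hN x) v)) = y := by
    rw [hL.layer_eq (hfeat T le_rfl) v] at hy
    obtain ⟨z, hz, rfl⟩ := (Part.mem_map_iff _).1 hy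
    exact (L.control hN).exists_firesAt_mem_done (i := (k, v, _)) hT hz
  choose T' hdone hres using fun v => hvertex v (Part.get_mem (hdom v))
  refine ⟨Finset.univ.sup T', ?_, fun t ht v => ?_⟩
  · simpa only [ev_ready_succ] using FiresAt.prod hdone
  · rw [ev_feat_succ, hres v t ((Finset.le_sup (Finset.mem_univ v)).trans ht), (hL k).2]
    rfl

theorem Available.ready_succ_eq_zero (hL : L.Implements M) {k : Fin d} {h : Fin n → ℝ}
    (hk : L.Available hN x k.castSucc h) (hdom : ¬ (M.relStep (adjRel hN x) (k + 1) h).Dom)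
    (t : ℕ) : (L.control hN).ev x t (L.ready hN k.succ) = 0 := by
  obtain ⟨T, hT, hfeat⟩ := hk
  obtain ⟨v, hv⟩ := not_forall.1 hdom
  rw [hL.layer_eq (hfeat T le_rfl) v] at hv
  rw [ev_ready_succ]
  exact Finset.prod_eq_zero (Finset.mem_univ v)
    ((L.control hN).mem_done_eq_zero_of_not_dom (i := (k, v, _)) hT hv t)

variable (hN x)

theorem Implements.available (hL : L.Implements M) (k : Fin (d + 1)) {h : Fin n → ℝ}
    (hh : h ∈ M.relFeats (adjRel hN x) (fun v => x (featIdx hN v)) k) :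
    L.Available hN x k h := by
  induction k using Fin.induction generalizing h with
  | zero => exact Part.mem_some_iff.1 hh ▸ L.available_zero hN x
  | succ k ih =>
    obtain ⟨g, hg, hh⟩ := Part.mem_bind_iff.1 hh
    exact (ih hg).succ hL hh

theorem Implements.ready_eq_zero (hL : L.Implements M) (k : Fin (d + 1))
    (hdom : ¬ (M.relFeats (adjRel hN x) (fun v => x (featIdx hN v)) k).Dom) (t : ℕ) :
    (L.control hN).ev x t (L.ready hN k) = 0 := by
  induction k using Fin.induction generalizing t with
  | zero => exact (hdom trivial).elim
  | succ k ih =>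
    by_cases hk : (M.relFeats (adjRel hN x) (fun v => x (featIdx hN v)) k).Dom
    · exact (hL.available hN x k.castSucc (Part.get_mem hk)).ready_succ_eq_zero hL
        (fun hstep => hdom ⟨hk, hstep⟩) t
    · rcases isEmpty_or_nonempty (Fin n) with hempty | ⟨⟨v⟩⟩
      · exact (hk (M.relFeats_dom (fun _ _ v => isEmptyElim v) _)).elim
      · rw [ev_ready_succ]
        exact Finset.prod_eq_zero (Finset.mem_univ v) <| (L.control hN).mem_done_eq_zero
          fun _ _ => (L.control hN).stopVal_eq_zero fun t' _ => ih hk t'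

theorem Implements.eval_toRec (hL : L.Implements M) {A : Set (ℝ → ℝ)} {W c D : ℕ}
    (hB : (L.bank n).Bounded A W D) (hK : (L.control hN).Bounded A W c) :
    (Control.toRec hB hK).eval x =
      (M.relFeats (adjRel hN x) (fun v => x (featIdx hN v)) d).map
        (Fin.append fun a => x (Fin.castLE hN (Fin.castAdd n a))) := by
  by_cases hdom : (M.relFeats (adjRel hN x) (fun v => x (featIdx hN v)) d).Dom
  · obtain ⟨h, hh⟩ := Part.dom_iff_mem.1 hdom
    obtain ⟨T, hT, hfeat⟩ := hL.available hN x (Fin.last d) hh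
    rw [Control.eval_toRec_of_firesAt hB hK hT, Part.eq_some_iff.2 hh, Part.map_some]
    refine congrArg Part.some (funext fun j => ?_)
    induction j using Fin.addCases with
    | left a => simp only [control, Fin.append_left]; rfl
    | right v => simpa only [control, Fin.append_right] using hfeat T le_rfl v
  · rw [Control.eval_toRec_of_forall hB hK (hL.ready_eq_zero hN x (Fin.last d) hdom),
      Part.eq_none_iff'.2 hdom, Part.map_none]

end Simulation

section Bounded

variable (L) {A : Set (ℝ → ℝ)} {W : ℕ} (hA : sgn ∈ A) (hact : ∀ k, L.act k ∈ A) (hW : n ≤ W)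

include hA

theorem bounded_edge (v w : Fin n) (c : ℕ) :
    (L.edge hN v w).Bounded A W (fun _ => True) (c + 1) := .func hA (.var trivial)

include hW

theorem bounded_degree (v : Fin n) : (L.degree hN v).Bounded A W (fun _ => True) 2 :=
  .sum ((Fintype.card_fin n).trans_le (by omega)) fun w => L.bounded_edge hN hA v w 0

theorem bounded_rank (v w : Fin n) : (L.rank hN v w).Bounded A W (fun _ => True) 2 :=
  .sum ((Fintype.card_fin n).trans_le (by omega)) fun w' => by
    split_ifs
    exacts [L.bounded_edge hN hA v w' 0, .const 0]

theorem bounded_ready (k : Fin (d + 1)) :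
    (L.ready hN k).Bounded A W (fun _ => True) 9 := by
  cases k using Fin.cases with
  | zero => exact .const 1
  | succ k =>
    exact .prod ((Fintype.card_fin n).trans_le (by omega)) fun v =>
      .select hA (by omega) (L.bounded_degree hN hA hW v) fun δ => .var trivial

include hact

theorem bounded_feat (k : Fin (d + 1)) (v : Fin n) :
    (L.feat hN k v).Bounded A W (fun _ => True) 9 := by
  cases k using Fin.cases with
  | zero => exact .var trivial
  | succ k =>
    exact .func (hact k) (.select hA (by omega) (L.bounded_degree hN hA hW v) fun δ => .var trivial)

theorem bounded_nbrFeat (k : Fin (d + 1)) (v : Fin n) (j : ℕ) :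
    (L.nbrFeat hN k v j).Bounded A W (fun _ => True) 12 :=
  .sum ((Fintype.card_fin n).trans_le (by omega)) fun w =>
    .mul (L.bounded_edge hN hA v w 9) <|
      .mul (((L.bounded_rank hN hA hW v w).isEq hA j).of_le (by omega))
        (L.bounded_feat hN hA hact hW k w)

theorem bounded_control : (L.control hN).Bounded A W 12 where
  start i := (L.bounded_ready hN hA hW i.1.castSucc).of_le (by omega)
  arg i j := by
    cases j using Fin.cases with
    | zero => exact (L.bounded_feat hN hA hact hW i.1.castSucc i.2.1).of_le (by omega)
    | succ j => exact L.bounded_nbrFeat hN hA hact hW i.1.castSucc i.2.1 j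
  out j := by
    induction j using Fin.addCases with
    | left a => simp only [control, Fin.append_left]; exact .var trivial
    | right v =>
      simp only [control, Fin.append_right]
      exact (L.bounded_feat hN hA hact hW (Fin.last d) v).of_le (by omega)
  halt := (L.bounded_ready hN hA hW (Fin.last d)).of_le (by omega)

end Bounded

end Layers

/-! ### Asymptotic bounds -/

theorem isBigO_atTop_iff_top {f g : ℕ → ℝ} (hg : ∀ n, g n ≠ 0) : f =O[atTop] g ↔ f =O[⊤] g := by
  rw [isBigO_nat_atTop_iff fun n hn => (hg n hn).elim, isBigO_top]

theorem isBigO_partialSups {f : ℕ → ℕ} {g : ℕ → ℝ} (hf : (fun n => (f n : ℝ)) =O[⊤] g)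
    (hg : Monotone g) (hg₀ : ∀ n, 0 ≤ g n) : (fun n => (partialSups f n : ℝ)) =O[⊤] g := by
  obtain ⟨C, hC⟩ := isBigO_top.1 hf
  refine isBigO_top.2 ⟨|C|, fun n => ?_⟩
  obtain ⟨j, hj, hfj⟩ := exists_partialSups_eq f n
  rw [hfj]
  refine (hC j).trans (mul_le_mul (le_abs_self C) ?_ (norm_nonneg _) (abs_nonneg C))
  rw [Real.norm_of_nonneg (hg₀ j), Real.norm_of_nonneg (hg₀ n)]
  exact hg hj

/-- `f n = n ^ O(1)`, as a bound valid for all `n` rather than for large `n` only; therefore `n + 1`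
takes the place of `n`. -/
def PolyBdd (f : ℕ → ℕ) : Prop :=
  ∃ q : ℕ, (fun n => (f n : ℝ)) =O[⊤] fun n : ℕ => ((n : ℝ) + 1) ^ q

/-- `f n = O((log n) ^ i)`, as a bound valid for all `n` rather than for large `n` only; therefore
`1 + log (n + 1)` takes the place of `log n`. -/
def LogBdd (i : ℕ) (f : ℕ → ℕ) : Prop :=
  (fun n => (f n : ℝ)) =O[⊤] fun n : ℕ => (1 + Real.log (n + 1)) ^ i

theorem one_le_one_add_log (n : ℕ) : 1 ≤ 1 + Real.log (n + 1) :=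
  le_add_of_nonneg_right (Real.log_nonneg (le_add_of_nonneg_left n.cast_nonneg))

theorem isTheta_natCast_add_one : (fun n : ℕ => (n : ℝ) + 1) =Θ[atTop] fun n : ℕ => (n : ℝ) :=
  (isTheta_refl _ _).add_isLittleO <| isLittleO_const_left.2 <| .inr <|
    tendsto_norm_atTop_atTop.comp tendsto_natCast_atTop_atTop

theorem isTheta_one_add_log :
    (fun n : ℕ => 1 + Real.log (n + 1)) =Θ[atTop] fun n : ℕ => Real.log n := by
  constructor
  · have hconst : (fun _ : ℕ => 1 + Real.log 2) =o[atTop] fun n : ℕ => Real.log n :=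
      Real.isLittleO_const_log_atTop.natCast_atTop
    refine IsBigO.trans (.of_bound' ?_) (hconst.isBigO.add (isBigO_refl _ _))
    filter_upwards [eventually_ge_atTop 1] with n hn
    have hn : (1 : ℝ) ≤ n := by exact_mod_cast hn
    have hlog : Real.log (n + 1) ≤ Real.log 2 + Real.log n := by
      rw [← Real.log_mul two_ne_zero (by positivity)]
      exact Real.log_le_log (by positivity) (by linarith)
    rw [Real.norm_of_nonneg (zero_le_one.trans (one_le_one_add_log n))]
    exact le_trans (by linarith) (Real.le_norm_self _)
  · refine .of_bound' ?_
    filter_upwards [eventually_ge_atTop 1] with n hn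
    have hlog : Real.log n ≤ Real.log (n + 1) :=
      Real.log_le_log (by exact_mod_cast hn) (by linarith)
    rw [Real.norm_of_nonneg (Real.log_natCast_nonneg n)]
    exact le_trans (by linarith) (Real.le_norm_self _)

theorem polyBdd_iff {f : ℕ → ℕ} :
    PolyBdd f ↔ ∃ q : ℕ, (fun n => (f n : ℝ)) =O[atTop] fun n : ℕ => (n : ℝ) ^ q := by
  refine exists_congr fun q => ?_
  rw [← isBigO_atTop_iff_top fun n => by positivity]
  exact (isTheta_natCast_add_one.pow q).isBigO_congr_right

theorem logBdd_iff {i : ℕ} {f : ℕ → ℕ} :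
    LogBdd i f ↔ (fun n => (f n : ℝ)) =O[atTop] fun n : ℕ => Real.log n ^ i := by
  rw [LogBdd, ← isBigO_atTop_iff_top fun n =>
    pow_ne_zero _ (zero_lt_one.trans_le (one_le_one_add_log n)).ne']
  exact (isTheta_one_add_log.pow i).isBigO_congr_right

namespace PolyBdd

variable {f g : ℕ → ℕ}

theorem mono (hg : PolyBdd g) (h : ∀ n, f n ≤ g n) : PolyBdd f := by
  obtain ⟨q, hq⟩ := hg
  exact ⟨q, (IsBigO.of_norm_le fun n => by simpa using h n).trans hq⟩

theorem const (k : ℕ) : PolyBdd fun _ => k :=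
  ⟨0, by simpa only [pow_zero] using isBigO_const_const (k : ℝ) one_ne_zero ⊤⟩

theorem id : PolyBdd fun n => n :=
  ⟨1, IsBigO.of_norm_le fun n => by simp⟩

theorem mul (hf : PolyBdd f) (hg : PolyBdd g) : PolyBdd fun n => f n * g n := by
  obtain ⟨q, hq⟩ := hf
  obtain ⟨q', hq'⟩ := hg
  exact ⟨q + q', by simpa only [Nat.cast_mul, pow_add] using hq.mul hq'⟩

theorem pow (hf : PolyBdd f) (k : ℕ) : PolyBdd fun n => f n ^ k := by
  obtain ⟨q, hq⟩ := hf
  exact ⟨q * k, by simpa only [Nat.cast_pow, pow_mul] using hq.pow k⟩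

theorem add (hf : PolyBdd f) (hg : PolyBdd g) : PolyBdd fun n => f n + g n := by
  obtain ⟨q, hq⟩ := hf
  obtain ⟨q', hq'⟩ := hg
  have hpow {a b : ℕ} (hab : a ≤ b) :
      (fun n : ℕ => ((n : ℝ) + 1) ^ a) =O[⊤] fun n : ℕ => ((n : ℝ) + 1) ^ b :=
    IsBigO.pow_of_le_right (.of_forall fun n => by simp) hab
  exact ⟨max q q', by simpa only [Nat.cast_add] using
    (hq.trans (hpow (le_max_left q q'))).add (hq'.trans (hpow (le_max_right q q')))⟩

theorem sum {ι : Type} (s : Finset ι) {f : ι → ℕ → ℕ} (h : ∀ i, PolyBdd (f i)) :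
    PolyBdd fun n => ∑ i ∈ s, f i n := by
  induction s using Finset.cons_induction with
  | empty => simpa only [Finset.sum_empty] using const 0
  | cons a s ha ih => simpa only [Finset.sum_cons] using (h a).add ih

theorem comp (hf : PolyBdd f) (hg : PolyBdd g) : PolyBdd fun n => f (g n) := by
  obtain ⟨q, hq⟩ := hf
  obtain ⟨q', hq'⟩ := hg.add (const 1)
  refine ⟨q' * q, (hq.comp_tendsto (k := g) tendsto_top).trans ?_⟩
  simpa only [Nat.cast_add, Nat.cast_one, pow_mul, Function.comp_def] using hq'.pow q

theorem partialSups (hf : PolyBdd f) : PolyBdd (partialSups f) := by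
  obtain ⟨q, hq⟩ := hf
  exact ⟨q, isBigO_partialSups hq (fun a b hab => by gcongr) fun n => by positivity⟩

theorem one_add_log_isBigO (hf : PolyBdd f) :
    (fun n => 1 + Real.log (f n + 1)) =O[⊤] fun n : ℕ => 1 + Real.log (n + 1) := by
  obtain ⟨q, hq⟩ := hf.add (const 1)
  obtain ⟨C, hC⟩ := isBigO_top.1 hq
  have hlogC : 0 ≤ Real.log (max C 1) := Real.log_nonneg (le_max_right C 1)
  refine isBigO_top.2 ⟨1 + Real.log (max C 1) + q, fun n => ?_⟩
  have hle : (f n : ℝ) + 1 ≤ max C 1 * ((n : ℝ) + 1) ^ q := by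
    have h := hC n
    rw [Real.norm_natCast, Nat.cast_add, Nat.cast_one, Real.norm_of_nonneg (by positivity)] at h
    exact h.trans (mul_le_mul_of_nonneg_right (le_max_left C 1) (by positivity))
  have hlog : Real.log (f n + 1) ≤ Real.log (max C 1) + q * Real.log (n + 1) := by
    rw [← Real.log_pow, ← Real.log_mul (by positivity) (by positivity)]
    exact Real.log_le_log (by positivity) hle
  rw [Real.norm_of_nonneg (zero_le_one.trans (one_le_one_add_log _)),
    Real.norm_of_nonneg (zero_le_one.trans (one_le_one_add_log _))]
  have hlogn : 0 ≤ Real.log (n + 1) := by linarith [one_le_one_add_log n]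
  nlinarith [mul_nonneg hlogC hlogn, q.cast_nonneg (α := ℝ)]

end PolyBdd

namespace LogBdd

variable {i : ℕ} {f g : ℕ → ℕ}

theorem mono (hg : LogBdd i g) (h : ∀ n, f n ≤ g n) : LogBdd i f :=
  (IsBigO.of_norm_le fun n => by simpa using h n).trans hg

theorem const (k : ℕ) : LogBdd i fun _ => k :=
  (isBigO_const_const (k : ℝ) (one_ne_zero' ℝ) ⊤).trans <| isBigO_of_le _ fun n =>
    norm_one.trans_le ((one_le_pow₀ (one_le_one_add_log n)).trans (Real.le_norm_self _))

theorem add (hf : LogBdd i f) (hg : LogBdd i g) : LogBdd i fun n => f n + g n := by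
  simpa only [LogBdd, Nat.cast_add] using IsBigO.add hf hg

theorem mul_const (hf : LogBdd i f) (k : ℕ) : LogBdd i fun n => f n * k := by
  simpa only [LogBdd, Nat.cast_mul, mul_comm] using IsBigO.const_mul_left hf (k : ℝ)

theorem sum {ι : Type} (s : Finset ι) {f : ι → ℕ → ℕ} (h : ∀ j, LogBdd i (f j)) :
    LogBdd i fun n => ∑ j ∈ s, f j n := by
  simpa only [LogBdd, Nat.cast_sum] using IsBigO.fun_sum fun j (_ : j ∈ s) => h j

theorem comp (hf : LogBdd i f) (hg : PolyBdd g) : LogBdd i fun n => f (g n) :=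
  (IsBigO.comp_tendsto hf (k := g) tendsto_top).trans (hg.one_add_log_isBigO.pow i)

theorem partialSups (hf : LogBdd i f) : LogBdd i (partialSups f) :=
  isBigO_partialSups hf
    (fun a b hab => by have := one_le_one_add_log a; gcongr)
    fun n => pow_nonneg (zero_le_one.trans (one_le_one_add_log n)) i

end LogBdd

theorem ExtFamily.isFamilyOf_iff {F : ExtFamily} {𝔉 : CircuitClass} : F.IsFamilyOf 𝔉 ↔
    PolyBdd (fun n => (F.circ n).size) ∧ LogBdd 𝔉.depthExp (fun n => (F.circ n).depth) ∧
      ∀ n, (F.circ n).UsesOnly 𝔉.gates := by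
  rw [polyBdd_iff, logBdd_iff, ExtFamily.IsFamilyOf]

/-! ### The sign circuits -/

/-- A system of one formula, for the sign of the last of `k` inputs. -/
abbrev signNetlist (k : ℕ) : Netlist k 0 1 where
  Wire := Unit
  fintypeWire := inferInstance
  form _ := if h : 0 < k then .func sgn (.var (.inl ⟨k - 1, Nat.sub_one_lt_of_lt h⟩)) else .const 0
  lev _ := 0
  out _ := ()

section SignCircuit

variable {A : Set (ℝ → ℝ)} (hA : sgn ∈ A)

include hA in
theorem bounded_signNetlist (k : ℕ) : (signNetlist k).Bounded A 0 1 0 where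
  form _ := by
    dsimp only
    split_ifs
    exacts [.func hA (.var trivial), .const 0]
  lev_le _ := le_rfl

/-- A circuit computing the sign of the last of `k` inputs. -/
def signCircuit (k : ℕ) : ExtCircuit k 0 1 := (bounded_signNetlist hA k).toCircuit

theorem eval_signCircuit (x : Fin 2 → ℝ) : (signCircuit hA 2).eval x Fin.elim0 0 = sgn (x 1) :=
  (bounded_signNetlist hA 2).eval_toCircuit (w := fun _ => sgn (x 1)) (fun _ => rfl) 0

theorem isFamilyOf_signCircuit {𝔉 : CircuitClass} (h𝔉 : sgn ∈ 𝔉.gates) :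
    ExtFamily.IsFamilyOf ⟨fun _ => 0, fun _ => 1, signCircuit h𝔉⟩ 𝔉 :=
  ExtFamily.isFamilyOf_iff.2
    ⟨(((PolyBdd.id.add (.const 0)).add (.const 1)).add (.const 6)).mono fun k =>
        (bounded_signNetlist h𝔉 k).size_toCircuit_le,
      (LogBdd.const _).mono fun k => (bounded_signNetlist h𝔉 k).depth_toCircuit_le,
      fun k => (bounded_signNetlist h𝔉 k).usesOnly_toCircuit⟩

end SignCircuit

/-! ### The encoding of a graph -/

/-- The number of vertices of a graph whose encoding has length `N`. -/
def vertexCount (N : ℕ) : ℕ := Nat.findGreatest (fun n => n * n + n ≤ N) N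

theorem vertexCount_spec (N : ℕ) : vertexCount N * vertexCount N + vertexCount N ≤ N :=
  Nat.findGreatest_spec (P := fun n => n * n + n ≤ N) N.zero_le N.zero_le

theorem vertexCount_le (N : ℕ) : vertexCount N ≤ N := Nat.findGreatest_le N

theorem vertexCount_mul_self_add (n : ℕ) : vertexCount (n * n + n) = n := by
  refine le_antisymm ?_ (Nat.le_findGreatest (Nat.le_add_left n _) le_rfl)
  by_contra! h
  nlinarith [vertexCount_spec (n * n + n)]

open Classical in
/-- The encoding of a labelled graph as a tuple. -/
def LGraph.encodeFn (G : LGraph) : Fin (G.card * G.card + G.card) → ℝ :=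
  Fin.append (fun a => if G.graph.Adj (finProdFinEquiv.symm a).1 (finProdFinEquiv.symm a).2
    then 1 else 0) G.feat

theorem LGraph.ofFn_encodeFn (G : LGraph) : List.ofFn G.encodeFn = G.encode := by
  have hidx (v w : Fin G.card) (h : (v : ℕ) * G.card + w < G.card * G.card) :
      finProdFinEquiv.symm ⟨v * G.card + w, h⟩ = (v, w) :=
    (Equiv.symm_apply_eq _).2 <| Fin.ext <| by
      simp only [finProdFinEquiv_apply_val, mul_comm, add_comm]
  rw [encodeFn, List.ofFn_fin_append, List.ofFn_mul]
  simp only [encode, List.flatMap_def, List.ofFn_eq_map]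
  congr 2
  refine List.map_congr_left fun v _ => List.map_congr_left fun w _ => ?_
  rw [hidx v w _]

theorem ExtFamily.IsFamilyOf.adjoin {F : ExtFamily} {𝔉 : CircuitClass} (hF : F.IsFamilyOf 𝔉)
    (A : Set (ℝ → ℝ)) : F.IsFamilyOf (𝔉.adjoin A) :=
  ⟨hF.1, hF.2.1, fun n g f p h => .inl (hF.2.2 n g f p h)⟩

theorem mem_recClass_adjoin {𝔊 𝔉 : CircuitClass} {f : List ℝ → Part (List ℝ)}
    (hf : f ∈ RecClass 𝔊 𝔉) (A : Set (ℝ → ℝ)) : f ∈ RecClass 𝔊 (𝔉.adjoin A) :=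
  let ⟨R, hR, hH, hf⟩ := hf
  ⟨R, hR.adjoin A, hH, hf⟩

namespace Layers

theorem adjRel_encodeFn (G : LGraph) : adjRel le_rfl G.encodeFn = G.graph.Adj := by
  funext v w
  have hval : G.encodeFn (adjIdx le_rfl v w) = _ := Fin.append_left _ _ (finProdFinEquiv (v, w))
  rw [adjRel, hval, Equiv.symm_apply_apply]
  split_ifs with h <;> simp only [h, zero_lt_one, lt_irrefl]

theorem encodeFn_featIdx (G : LGraph) (v : Fin G.card) :
    G.encodeFn (featIdx le_rfl v) = G.feat v := Fin.append_right _ _ v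

/-! ### The circuit family simulating a network -/

variable {d : ℕ} (L : Layers d)

/-- The total size of the circuits of `L` used at vertices of degree `δ`. -/
def totalSize (δ : ℕ) : ℕ :=
  ∑ k, ((L.R k (δ + 1)).C.size + (L.H k ((L.R k (δ + 1)).numHalt + 1)).size)

/-- The total depth of the circuits of `L` used at vertices of degree `δ`. -/
def totalDepth (δ : ℕ) : ℕ :=
  ∑ k, ((L.R k (δ + 1)).C.depth + (L.H k ((L.R k (δ + 1)).numHalt + 1)).depth)

/-- A common bound for the sizes and arities of the circuits of `L` used on graphs with `n`
vertices. -/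
def width (n : ℕ) : ℕ := partialSups L.totalSize n + (n + 1)

/-- A common bound for the depths of the circuits of `L` used on graphs with `n` vertices. -/
def maxDepth (n : ℕ) : ℕ := partialSups L.totalDepth n

variable {L}

theorem le_width (n : ℕ) : n ≤ L.width n := by
  rw [width]
  omega

theorem size_add_size_le_width (k : Fin d) {δ n : ℕ} (hδ : δ ≤ n) :
    (L.R k (δ + 1)).C.size + (L.H k ((L.R k (δ + 1)).numHalt + 1)).size ≤ L.width n := calc
  _ ≤ L.totalSize δ := Finset.single_le_sum
    (f := fun k => (L.R k (δ + 1)).C.size + (L.H k ((L.R k (δ + 1)).numHalt + 1)).size)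
    (fun _ _ => Nat.zero_le _) (Finset.mem_univ k)
  _ ≤ partialSups L.totalSize n := le_partialSups_of_le _ hδ
  _ ≤ L.width n := Nat.le_add_right _ _

theorem depth_add_depth_le_maxDepth (k : Fin d) {δ n : ℕ} (hδ : δ ≤ n) :
    (L.R k (δ + 1)).C.depth + (L.H k ((L.R k (δ + 1)).numHalt + 1)).depth ≤ L.maxDepth n := calc
  _ ≤ L.totalDepth δ := Finset.single_le_sum
    (f := fun k => (L.R k (δ + 1)).C.depth + (L.H k ((L.R k (δ + 1)).numHalt + 1)).depth)
    (fun _ _ => Nat.zero_le _) (Finset.mem_univ k)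
  _ ≤ L.maxDepth n := le_partialSups_of_le _ hδ

theorem bank_arity_le (n : ℕ) (i : (L.bank n).Index) : (L.bank n).arity i ≤ L.width n :=
  (Nat.succ_le_of_lt i.2.2.isLt).trans (Nat.le_add_left _ _)

/-- All ingredients of `L` are available in the circuit function class `𝔉`. -/
structure IsOver (L : Layers d) (𝔉 : CircuitClass) : Prop where
  circ : ∀ k, (L.R k).underlying.IsFamilyOf 𝔉
  haltCirc : ∀ k, ExtFamily.IsFamilyOf ⟨fun _ => 0, fun _ => 1, L.H k⟩ 𝔉
  act : ∀ k, L.act k ∈ 𝔉.gates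
  sgn : sgn ∈ 𝔉.gates

namespace IsOver

variable {𝔉 : CircuitClass} (hL : L.IsOver 𝔉)

include hL

theorem bounded_bank (n : ℕ) : (L.bank n).Bounded 𝔉.gates (L.width n) (L.maxDepth n) where
  usesOnly i := (hL.circ i.1).2.2 _
  usesOnly_halt i := (hL.haltCirc i.1).2.2 _
  size_le i := (Nat.le_add_right _ _).trans (size_add_size_le_width i.1 i.2.2.is_le)
  size_halt_le i := (Nat.le_add_left _ _).trans (size_add_size_le_width i.1 i.2.2.is_le)
  depth_le i := (Nat.le_add_right _ _).trans (depth_add_depth_le_maxDepth i.1 i.2.2.is_le)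
  depth_halt_le i := (Nat.le_add_left _ _).trans (depth_add_depth_le_maxDepth i.1 i.2.2.is_le)

theorem bounded_control (N : ℕ) : (L.control (vertexCount_spec N)).Bounded 𝔉.gates
    (L.width (vertexCount N)) 12 :=
  L.bounded_control _ hL.sgn hL.act (le_width _)

theorem polyBdd_numHalt (k : Fin d) : PolyBdd fun δ => (L.R k (δ + 1)).numHalt + 1 := by
  have hsize := (ExtFamily.isFamilyOf_iff.1 (hL.circ k)).1.comp (PolyBdd.id.add (.const 1))
  refine (hsize.mono fun δ => ?_).add (.const 1)
  have h := Fintype.card_le_of_injective _ (L.R k (δ + 1)).haltGate.injective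
  rwa [Fintype.card_fin] at h

theorem polyBdd_width : PolyBdd L.width := by
  refine PolyBdd.add (.partialSups (.sum _ fun k => .add ?_ ?_)) (PolyBdd.id.add (.const 1))
  · exact (ExtFamily.isFamilyOf_iff.1 (hL.circ k)).1.comp (PolyBdd.id.add (.const 1))
  · exact (ExtFamily.isFamilyOf_iff.1 (hL.haltCirc k)).1.comp (hL.polyBdd_numHalt k)

theorem logBdd_maxDepth : LogBdd 𝔉.depthExp L.maxDepth := by
  refine .partialSups (.sum _ fun k => .add ?_ ?_)
  · exact (ExtFamily.isFamilyOf_iff.1 (hL.circ k)).2.1.comp (PolyBdd.id.add (.const 1))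
  · exact (ExtFamily.isFamilyOf_iff.1 (hL.haltCirc k)).2.1.comp (hL.polyBdd_numHalt k)

/-- The recurrent circuits simulating a network: for `N` inputs, the simulation on graphs with
`vertexCount N` vertices. Inputs beyond the encoding of such a graph are ignored. -/
def family : RecFamily := fun N =>
  Control.toRec (hL.bounded_bank (vertexCount N)) (hL.bounded_control N)

theorem polyBdd_size_family : PolyBdd fun N => (hL.family N).C.size := by
  have hn : PolyBdd vertexCount := PolyBdd.id.mono vertexCount_le
  have hW : PolyBdd fun N => L.width (vertexCount N) := hL.polyBdd_width.comp hn
  have hI : PolyBdd fun N => Fintype.card (L.bank (vertexCount N)).Index := by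
    simpa only [Fintype.card_prod, Fintype.card_fin] using
      (PolyBdd.const d).mul (hn.mul (hn.add (.const 1)))
  have hm : PolyBdd fun N => vertexCount N * vertexCount N + vertexCount N := (hn.mul hn).add hn
  refine PolyBdd.mono ?_ fun N => Control.size_toRec_le (hL.bounded_bank (vertexCount N))
    (hL.bounded_control N) (bank_arity_le _)
  exact ((PolyBdd.id.add (hI.mul (((PolyBdd.const 2).mul hW).add (.const 4)))).add hm).add
    ((((hI.mul (((PolyBdd.const 4).mul hW).add (.const 4))).add hm).add (.const 1)).mul
      ((PolyBdd.const 2).mul ((hW.add (.const 3)).pow _)))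

theorem logBdd_depth_family : LogBdd 𝔉.depthExp fun N => (hL.family N).C.depth :=
  have hD : LogBdd 𝔉.depthExp fun N => L.maxDepth (vertexCount N) :=
    hL.logBdd_maxDepth.comp (PolyBdd.id.mono vertexCount_le)
  ((((hD.mul_const 2).add (.const 3)).mul_const _).add (.const 1)).mono fun N =>
    mul_comm 2 (L.maxDepth (vertexCount N)) ▸
      Control.depth_toRec_le (hL.bounded_bank (vertexCount N)) (hL.bounded_control N)

theorem isFamilyOf_family : hL.family.underlying.IsFamilyOf 𝔉 :=
  ExtFamily.isFamilyOf_iff.2 ⟨hL.polyBdd_size_family, hL.logBdd_depth_family, fun N =>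
    Control.usesOnly_toRec (hL.bounded_bank (vertexCount N)) (hL.bounded_control N)⟩

theorem haltsIn_family {𝔊 : CircuitClass} (h𝔊 : RecGNN.sgn ∈ 𝔊.gates) : hL.family.HaltsIn 𝔊 := by
  refine ⟨signCircuit h𝔊, isFamilyOf_signCircuit h𝔊, fun N i v _ =>
    (eval_signCircuit h𝔊 _).trans ?_⟩
  change RecGNN.sgn (v (0 : Fin 1)) = if decide (0 < v (0 : Fin 1)) = true then 1 else 0
  simp only [RecGNN.sgn, decide_eq_true_eq]

variable {M : RecCGNN} (hM : L.Implements M)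

include hM

theorem eval_family_ofFn {N n : ℕ} (hn : vertexCount N = n) (hN : n * n + n ≤ N)
    (x : Fin N → ℝ) :
    hL.family.eval (List.ofFn x) =
      (M.relFeats (adjRel hN x) (fun v => x (featIdx hN v)) d).map fun h =>
        List.ofFn (Fin.append (fun a => x (Fin.castLE hN (Fin.castAdd n a))) h) := by
  subst hn
  rw [RecFamily.eval_ofFn]
  refine (congrArg (Part.map List.ofFn)
    (hM.eval_toRec hN x (hL.bounded_bank _) (hL.bounded_control N))).trans ?_
  rw [Part.map_map]
  rfl

theorem dom_eval_family (hdom : ∀ i x, (M.layer i x).Dom) (x : List ℝ) :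
    (hL.family.eval x).Dom := by
  have h := hL.eval_family_ofFn hM rfl (vertexCount_spec x.length) x.get
  rw [List.ofFn_get] at h
  rw [h]
  exact M.relFeats_dom (fun i g v => hdom _ _) _

theorem eval_family_encode (G : LGraph) : hL.family.eval G.encode =
    (M.relFeats G.graph.Adj G.feat d).map fun h => LGraph.encode { G with feat := h } := by
  have h := hL.eval_family_ofFn hM (vertexCount_mul_self_add G.card) le_rfl G.encodeFn
  rw [G.ofFn_encodeFn, adjRel_encodeFn] at h
  simp only [encodeFn_featIdx] at h
  refine h.trans (congrArg (Part.map · _) (funext fun g => ?_))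
  rw [← LGraph.ofFn_encodeFn]
  congr 2
  exact funext fun a => Fin.append_left _ _ a

end IsOver

end Layers

end RecGNN

end

theorem mainTheorem4_general (𝔊 : RecGNN.CircuitClass) (h𝔊 : RecGNN.sgn ∈ 𝔊.gates)
    (A : Set (ℝ → ℝ)) (N : RecGNN.RecCGNN)
    (hlayer : ∀ i, (fun x => (N.layer i x).map fun y => [y]) ∈ RecGNN.RecClass 𝔊 𝔊)
    (hact : ∀ i, N.act i ∈ A) {d : ℕ} (hd : 1 ≤ d) (hhalt : ∀ i l, N.halt i l = decide (i = d)) :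
    ∃ f ∈ RecGNN.RecClass 𝔊 (𝔊.adjoin A),
      (∀ G : RecGNN.LGraph, f G.encode = (N.eval G).map RecGNN.LGraph.encode) ∧
      ((∀ i x, (N.layer i x).Dom) → ∀ x, (f x).Dom) := by
  choose R hR hRH hRe using fun k : Fin d => hlayer (k + 1)
  choose H hH hHe using hRH
  let L : RecGNN.Layers d := ⟨R, H, hHe, fun k => N.act (k + 1)⟩
  have hL : L.IsOver (𝔊.adjoin A) :=
    { circ := fun k => (hR k).adjoin A
      haltCirc := fun k => (hH k).adjoin A
      act := fun k => .inr (hact (k + 1))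
      sgn := .inl h𝔊 }
  have hM : L.Implements N := fun k => ⟨hRe k, rfl⟩
  refine ⟨hL.family.eval, ⟨hL.family, hL.isFamilyOf_family, hL.haltsIn_family h𝔊, rfl⟩,
    fun G => ?_, hL.dom_eval_family hM⟩
  rw [hL.eval_family_encode hM, N.eval_eq hd hhalt, Part.map_map]
  rfl

theorem mainTheorem4 (𝔉 : RecGNN.CircuitClass) (A : Set (ℝ → ℝ)) (N : RecGNN.RecCGNN)
    (hN : N.IsInnerRecurrent 𝔉 A) :
    ∃ f ∈ RecGNN.RecClass 𝔉.withSign (𝔉.withSign.adjoin A),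
      (∀ G : RecGNN.LGraph, f G.encode = (N.eval G).map RecGNN.LGraph.encode) ∧
      ((∀ i x, (N.layer i x).Dom) → ∀ x, (f x).Dom) := by
  obtain ⟨hlayer, hact, _, hd, hhalt⟩ := hN
  exact mainTheorem4_general 𝔉.withSign (.inr rfl) A N
    (fun i => RecGNN.mem_recClass_adjoin (hlayer i).2 {RecGNN.sgn}) hact hd hhalt
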